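/- Let $n,r\ge 1$. For weights $m_1,\dots,m_n\in\mathbb Z^r$ let the torus $T^r=\{\lambda\in\mathbb C^r: |\lambda_1|=\dots=|\lambda_r|=1\}$ act linearly on $\mathbb C^n$ by $\rho(\lambda)z=(\lambda^{m_1}z_1,\dots,\lambda^{m_n}z_n)$, where $\lambda^{m_i}=\prod_{j=1}^r\lambda_j^{m_{ij}}$, and assume that the only $\rho$-invariant holomorphic functions on $\mathbb C^n$ are the constants. A bounded domain $D\subset\mathbb C^n$ containing the origin is called quasi-Reinhardt (of rank $r$, with weight $m=(m_1,\dots,m_n)$) if it is invariant under such an action $\rho$. Its resonance order is $$\mu(m)=\max_{1\le i\le n}\ \max\Big\{|\alpha|=\sum_{k=1}^n\alpha_k:\ \alpha\in\mathbb N^n,\ \sum_{k=1}^n\alpha_k m_{kj}=m_{ij}\ \text{ for } 1\le j\le r\Big\}.$$ Let $K_D(z,w)$ be the Bergman kernel of $D$ (the reproducing kernel of the space of square integrable holomorphic functions on $D$), let $T_D(z,w)$ be the $n\times n$ matrix with entries $\frac{\partial^2}{\partial\bar w_i\,\partial z_k}\log K_D(z,w)$, and let $$\sigma_0^D(z)=T_D(0,0)^{-1}\,\mathrm{grad}_{\bar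 w}\log\frac{K_D(z,w)}{K_D(w,w)}\Big|_{w=0},\qquad z\in D,$$ be the Bergman representative coordinates of $D$ at $0$ (defined on all of $D$, because $K_D(z,0)=K_D(0,0)>0$ for every $z$ in a quasi-Reinhardt domain $D$). **Theorem.** Let $D_1,D_2\subset\mathbb C^n$ be bounded quasi-Reinhardt domains, with weights $m^{(1)},m^{(2)}$ of possibly different ranks, and let $f:D_1\to D_2$ be a biholomorphism with $f(0)=0$. Put $\sigma^i=\sigma_0^{D_i}$ for $i=1,2$, and let $J_f=df_0:\mathbb C^n\to\mathbb C^n$ be the linear part of $f$ at $0$. Then $\sigma^1$ and $\sigma^2$ are injective on $D_1$ and $D_2$, and, with $(\sigma^i)^{-1}:\sigma^i(D_i)\to D_i$ denoting the inverse maps, (i) $J_f$ maps $\sigma^1(D_1)$ into $\sigma^2(D_2)$, and $f=(\sigma^2)^{-1}\circ J_f\circ\sigma^1$ on $D_1$; (ii) for $i=1,2$, both $\sigma^i$ and $(\sigma^i)^{-1}$ are (restrictions to $D_i$ and $\sigma^i(D_i)$ of) polynomial maps $\mathbb C^n\to\mathbb C^n$ all of whose components have degree at most the resonance order $\mu(m^{(i)})$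 of $D_i$. -/

import Mathlib

open MeasureTheory
open scoped ComplexConjugate

noncomputable section

namespace QuasiReinhardt

/-! Points of `ℂⁿ` are functions `Fin n → ℂ`. The norm of this type is the maximum norm (only
openness, boundedness and differentiability are used, which do not depend on the norm), and its
`volume` is Lebesgue measure on `ℂⁿ = ℝ²ⁿ`. -/

/-! ### Torus actions, quasi-Reinhardt domains, resonance order -/

/-- The linear action of the torus `Tʳ` on `ℂⁿ` with weights `m₁, …, mₙ ∈ ℤʳ`:
`ρ(lam) z = (lam^{m₁} z₁, …, lam^{mₙ} zₙ)`, where `lam^{mᵢ} = ∏ⱼ lamⱼ^{mᵢⱼ}`. -/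
def torusAction {n r : ℕ} (m : Fin n → Fin r → ℤ) (lam : Fin r → Circle) (z : Fin n → ℂ) :
    Fin n → ℂ :=
  fun i => ((∏ j, lam j ^ m i j : Circle) : ℂ) * z i

/-- The only holomorphic functions on `ℂⁿ` that are invariant under the action are constant. -/
def OnlyConstantInvariants {n r : ℕ} (m : Fin n → Fin r → ℤ) : Prop :=
  ∀ g : (Fin n → ℂ) → ℂ, Differentiable ℂ g →
    (∀ (lam : Fin r → Circle) (z : Fin n → ℂ), g (torusAction m lam z) = g z) →
    ∀ z w : Fin n → ℂ, g z = g w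

/-- `D` is a bounded quasi-Reinhardt domain (of rank `r`) with respect to the torus action of
weight `m`: a bounded domain containing the origin, invariant under the action, where the action
has only constant invariant holomorphic functions on `ℂⁿ`. -/
structure IsQuasiReinhardt {n r : ℕ} (m : Fin n → Fin r → ℤ) (D : Set (Fin n → ℂ)) : Prop where
  isOpen : IsOpen D
  isConnected : IsConnected D
  isBounded : Bornology.IsBounded D
  zero_mem : (0 : Fin n → ℂ) ∈ D
  onlyConstantInvariants : OnlyConstantInvariants m
  invariant : ∀ (lam : Fin r → Circle), ∀ z ∈ D, torusAction m lam z ∈ D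

/-- The `i`-th resonance set: all `α ∈ ℕⁿ` with `∑ₖ αₖ mₖⱼ = mᵢⱼ` for all `j`. -/
def resonanceSet {n r : ℕ} (m : Fin n → Fin r → ℤ) (i : Fin n) : Set (Fin n → ℕ) :=
  {α | ∀ j, ∑ k, (α k : ℤ) * m k j = m i j}

/-- The `i`-th resonance order: the maximum of `|α|` over the `i`-th resonance set (this set is
nonempty, and finite if the action has only constant invariants). -/
def resonanceOrderAt {n r : ℕ} (m : Fin n → Fin r → ℤ) (i : Fin n) : ℕ :=
  sSup ((fun α : Fin n → ℕ => ∑ k, α k) '' resonanceSet m i)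

/-- The resonance order: the maximum of the `i`-th resonance orders. -/
def resonanceOrder {n r : ℕ} (m : Fin n → Fin r → ℤ) : ℕ :=
  Finset.univ.sup (resonanceOrderAt m)

/-! ### Bergman kernel -/

/-- Membership in the Bergman space: square integrable holomorphic functions on `D`. -/
def MemBergman {n : ℕ} (D : Set (Fin n → ℂ)) (g : (Fin n → ℂ) → ℂ) : Prop :=
  DifferentiableOn ℂ g D ∧ MemLp g 2 (volume.restrict D)

/-- `K` is a reproducing kernel of the Bergman space of `D`: for `w ∈ D`, the function `K(·, w)`
lies in the Bergman space, and `g(w) = ∫_D g(z) conj (K(z, w)) dV(z)` for all `g` in it. -/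
structure IsBergmanKernel {n : ℕ} (D : Set (Fin n → ℂ))
    (K : (Fin n → ℂ) → (Fin n → ℂ) → ℂ) : Prop where
  mem : ∀ w ∈ D, MemBergman D (fun z => K z w)
  reproducing : ∀ g : (Fin n → ℂ) → ℂ, MemBergman D g → ∀ w ∈ D,
    g w = ∫ z in D, g z * conj (K z w)

theorem IsBergmanKernel.eq_conj {n : ℕ} {D : Set (Fin n → ℂ)}
    {K K' : (Fin n → ℂ) → (Fin n → ℂ) → ℂ} (hK : IsBergmanKernel D K)
    (hK' : IsBergmanKernel D K') {z w : Fin n → ℂ} (hz : z ∈ D) (hw : w ∈ D) :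
    K z w = conj (K' w z) := by
  rw [hK.reproducing _ (hK'.mem z hz) w hw, hK'.reproducing _ (hK.mem w hw) z hz, ← integral_conj]
  simp [mul_comm]

/-- A reproducing kernel of the Bergman space is uniquely determined on `D × D`. -/
theorem IsBergmanKernel.unique {n : ℕ} {D : Set (Fin n → ℂ)}
    {K K' : (Fin n → ℂ) → (Fin n → ℂ) → ℂ} (hK : IsBergmanKernel D K)
    (hK' : IsBergmanKernel D K') {z w : Fin n → ℂ} (hz : z ∈ D) (hw : w ∈ D) :
    K z w = K' z w := by
  rw [hK.eq_conj hK' hz hw, ← hK'.eq_conj hK' hz hw]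

open Classical in
/-- The Bergman kernel `K_D(z, w)`: the reproducing kernel of the Bergman space of `D`. Only its
values on `D × D` matter; they are determined by `IsBergmanKernel.unique`. -/
def bergmanKernel {n : ℕ} (D : Set (Fin n → ℂ)) : (Fin n → ℂ) → (Fin n → ℂ) → ℂ :=
  if h : ∃ K, IsBergmanKernel D K then h.choose else 0

theorem isBergmanKernel_bergmanKernel {n : ℕ} {D : Set (Fin n → ℂ)}
    (h : ∃ K, IsBergmanKernel D K) : IsBergmanKernel D (bergmanKernel D) := by
  unfold bergmanKernel
  rw [dif_pos h]
  exact h.choose_spec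

/-! ### Bergman metric tensor and representative coordinates -/

/-- The Wirtinger derivative `∂g/∂zₖ = (∂g/∂xₖ - i ∂g/∂yₖ) / 2`. -/
def wirtinger {n : ℕ} (k : Fin n) (g : (Fin n → ℂ) → ℂ) (z : Fin n → ℂ) : ℂ :=
  (fderiv ℝ g z (Pi.single k 1) - Complex.I * fderiv ℝ g z (Pi.single k Complex.I)) / 2

/-- The Wirtinger derivative `∂g/∂z̄ₖ = (∂g/∂xₖ + i ∂g/∂yₖ) / 2`. -/
def wirtingerBar {n : ℕ} (k : Fin n) (g : (Fin n → ℂ) → ℂ) (z : Fin n → ℂ) : ℂ :=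
  (fderiv ℝ g z (Pi.single k 1) + Complex.I * fderiv ℝ g z (Pi.single k Complex.I)) / 2

/-- The Bergman metric tensor `T_D(z, w)`, with entries
`tᵢₖ(z, w) = ∂²/∂w̄ᵢ∂zₖ log K_D(z, w)`. It is used below at `z = w = ξ ∈ D` only, where
`K_D(ξ, ξ) > 0`, so that the principal branch of the logarithm is smooth near there. -/
def bergmanTensor {n : ℕ} (D : Set (Fin n → ℂ)) (z w : Fin n → ℂ) : Matrix (Fin n) (Fin n) ℂ :=
  Matrix.of fun i k =>
    wirtingerBar i (fun w' => wirtinger k (fun z' => Complex.log (bergmanKernel D z' w')) z) w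

/-- The Bergman representative coordinates
`σ_ξ(z) = T_D(ξ, ξ)⁻¹ grad_{w̄} log (K_D(z, w) / K_D(w, w)) |_{w = ξ}`, for `z ∈ D` such that the
quotient is not in `(-∞, 0]` at `w = ξ`. For the quasi-Reinhardt domains above and `ξ = 0` these
are all `z ∈ D`, since then `K_D(z, 0) = K_D(0, 0) > 0`. -/
def bergmanCoord {n : ℕ} (D : Set (Fin n → ℂ)) (ξ z : Fin n → ℂ) : Fin n → ℂ :=
  (bergmanTensor D ξ ξ)⁻¹.mulVec fun i =>
    wirtingerBar i (fun w => Complex.log (bergmanKernel D z w / bergmanKernel D w w)) ξ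

/-! ### Biholomorphisms and polynomial maps -/

/-- `f` is a biholomorphism from `D₁` onto `D₂`. -/
def IsBiholomorphism {n : ℕ} (f : (Fin n → ℂ) → (Fin n → ℂ)) (D₁ D₂ : Set (Fin n → ℂ)) : Prop :=
  DifferentiableOn ℂ f D₁ ∧ Set.MapsTo f D₁ D₂ ∧
    ∃ g : (Fin n → ℂ) → (Fin n → ℂ), DifferentiableOn ℂ g D₂ ∧ Set.MapsTo g D₂ D₁ ∧
      Set.LeftInvOn g f D₁ ∧ Set.RightInvOn g f D₂

/-- On `S`, the map `F` is a polynomial map of degree at most `d`. -/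
def IsPolynomialMapOn {n : ℕ} (F : (Fin n → ℂ) → (Fin n → ℂ)) (S : Set (Fin n → ℂ)) (d : ℕ) :
    Prop :=
  ∃ P : Fin n → MvPolynomial (Fin n) ℂ,
    (∀ i, (P i).totalDegree ≤ d) ∧ ∀ z ∈ S, ∀ i, F z i = MvPolynomial.eval z (P i)

end QuasiReinhardt

end

/-! The argument rests on one observation: the origin is fixed by the torus and invariant
holomorphic functions are constant, so `K_D(·, 0)` is constant on `D`. This removes the logarithms.
With `G_i(z) = ∂K_D(z, w)/∂w̄_i` at `w = 0` (`kernelGrad`) and `A` the derivative matrix of `G` at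
`0` (`kernelHess`), one gets `T_D(0, 0) = K_D(0, 0)⁻¹ A` and `σ_0 = A⁻¹ G`
(`IsQuasiReinhardt.bergmanCoord_eq`). The `G_i` represent the functionals `g ↦ ∂g/∂z_i(0)` on the
Bergman space, so `A` is their Gram matrix; it is invertible because the coordinate functions are
square integrable on a bounded domain.

Setting `w = 0` in the transformation law of the kernels shows that the Jacobian determinant of `f`
is constant, so `K_{D₁}(z, w) = s K_{D₂}(f z, f w)` with `s` real. Differentiating at the origin
yields `J_f ∘ σ¹ = σ² ∘ f` (`IsQuasiReinhardt.fderiv_kernelCoord`), which gives (i) once `σ²` is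
known to be injective. Applied to the torus elements themselves, which are automorphisms fixing `0`,
the same identity says that `σ` is equivariant.

Hence the `i`-th component of `σ` is semi-invariant of weight `m_i`, and only monomials `z^α` with
`∑ α_k m_k = m_i` occur in its Taylor series. Since there are no nonconstant invariant monomials,
Dickson's lemma leaves finitely many such `α`, so `σ` is polynomial with the resonance order as
degree bound. As `σ` is tangent to the identity at `0`, it has a local inverse there, again
equivariant and hence polynomial with the same bound; the identity theorem extends `Q ∘ σ = id` from
a neighbourhood of `0` to `D`. This gives injectivity and (ii) together. -/

noncomputable section

namespace QuasiReinhardt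

open Metric Set Filter Topology

/-! ### Holomorphic functions of several variables -/

section SeveralVariables

variable {E : Type*} [NormedAddCommGroup E] [NormedSpace ℂ E]

/-- Cauchy's estimate for the derivative. -/
theorem norm_fderiv_le_of_bounded_on_ball {g : E → ℂ} {z : E} {r M : ℝ} (hr : 0 < r)
    (hg : DifferentiableOn ℂ g (ball z r)) (hM : ∀ w ∈ ball z r, ‖g w‖ ≤ M) :
    ‖fderiv ℂ g z‖ ≤ 2 * M / r := by
  have hM0 : 0 ≤ M := (norm_nonneg _).trans (hM z (mem_ball_self hr))
  refine ContinuousLinearMap.opNorm_le_bound _ (by positivity) fun v => ?_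
  rcases eq_or_ne v 0 with rfl | hv
  · simp
  have hv' : 0 < ‖v‖ := norm_pos_iff.2 hv
  -- Half the admissible radius keeps the closed disc inside the open ball; this is the source of
  -- the factor 2.
  have hmem : ∀ t ∈ closedBall (0 : ℂ) (r / (2 * ‖v‖)), z + t • v ∈ ball z r := by
    intro t ht
    rw [mem_closedBall_zero_iff] at ht
    rw [mem_ball, dist_eq_norm, add_sub_cancel_left, norm_smul]
    calc ‖t‖ * ‖v‖ ≤ r / (2 * ‖v‖) * ‖v‖ := by gcongr
      _ = r / 2 := by field_simp
      _ < r := by linarith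
  have hd : DifferentiableOn ℂ (fun t : ℂ => g (z + t • v)) (closedBall 0 (r / (2 * ‖v‖))) :=
    hg.comp (by fun_prop) hmem
  have h0 : HasDerivAt (fun t : ℂ => g (z + t • v)) (fderiv ℂ g z v) 0 := by
    have h1 : HasFDerivAt g (fderiv ℂ g z) (z + (0 : ℂ) • v) := by
      simpa using (hg.differentiableAt (ball_mem_nhds z hr)).hasFDerivAt
    have h2 : HasDerivAt (fun t : ℂ => z + t • v) v 0 := by
      simpa using ((hasDerivAt_id (0 : ℂ)).smul_const v).const_add z
    exact h1.comp_hasDerivAt _ h2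
  have h3 := Complex.norm_deriv_le_of_forall_mem_sphere_norm_le (c := 0) (C := M)
    (R := r / (2 * ‖v‖)) (by positivity) (DifferentiableOn.diffContOnCl_ball hd subset_rfl)
    fun t ht => hM _ (hmem t (sphere_subset_closedBall ht))
  rw [h0.deriv] at h3
  refine h3.trans_eq ?_
  field_simp

/-- A holomorphic function is locally bounded. -/
theorem exists_ball_bounded {g : E → ℂ} {D : Set E} (hD : IsOpen D) (hg : DifferentiableOn ℂ g D)
    {w : E} (hw : w ∈ D) : ∃ r > 0, ∃ M, ball w r ⊆ D ∧ ∀ z ∈ ball w r, ‖g z‖ ≤ M := by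
  have h1 : ∀ᶠ z in 𝓝 w, ‖g z‖ < ‖g w‖ + 1 :=
    (hg.continuousOn.continuousAt (hD.mem_nhds hw)).norm.eventually_lt_const (by simp)
  obtain ⟨r, hr, h⟩ := Metric.mem_nhds_iff.1 (h1.and (hD.mem_nhds hw))
  exact ⟨r, hr, ‖g w‖ + 1, fun z hz => (h hz).2, fun z hz => (h hz).1.le⟩

/-- The identity theorem. -/
theorem eqOn_zero_of_eventuallyEq_zero {g : E → ℂ} {D : Set E} (hD : IsOpen D)
    (hc : IsPreconnected D) (hg : DifferentiableOn ℂ g D) {z₀ : E} (hz₀ : z₀ ∈ D)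
    (h : g =ᶠ[𝓝 z₀] 0) : ∀ z ∈ D, g z = 0 := by
  -- The set of points near which `g` vanishes is open; it remains to see that it is relatively
  -- closed in `D`.
  set S : Set E := {z | g =ᶠ[𝓝 z] 0} with hS
  have hSo : IsOpen S := isOpen_setOfPred_eventually_nhds
  suffices D ⊆ S from fun z hz => (this hz).self_of_nhds
  refine hc.subset_of_closure_inter_subset hSo ⟨z₀, hz₀, h⟩ ?_
  rintro z ⟨hzS, hzD⟩
  obtain ⟨r, hr, hrD⟩ := Metric.isOpen_iff.1 hD z hzD
  obtain ⟨s, hs, hsz⟩ := Metric.mem_closure_iff.1 hzS r hr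
  rw [dist_comm] at hsz
  refine Filter.eventually_of_mem (ball_mem_nhds z hr) fun w hw => ?_
  -- On the complex line from `s ∈ S` to `w`, the part inside the ball is convex, so the
  -- one-variable identity theorem carries the vanishing from `t = 0` to `t = 1`.
  set L : ℂ → E := fun t => s + t • (w - s) with hL
  have hLd : Differentiable ℂ L := by fun_prop
  set U : Set ℂ := L ⁻¹' ball z r with hU
  have hUo : IsOpen U := isOpen_ball.preimage hLd.continuous
  have hUc : Convex ℝ U := by
    intro a ha b hb p q hp hq hpq
    have : L (p • a + q • b) = p • L a + q • L b := by
      have : (p : ℂ) + q = 1 := by exact_mod_cast hpq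
      simp only [hL, Complex.real_smul, smul_add, add_smul, mul_smul, Complex.coe_smul]
      have h2 : s = p • s + q • s := by rw [← add_smul, hpq, one_smul]
      nth_rewrite 1 [h2]
      abel
    simp only [hU, mem_preimage] at ha hb ⊢
    rw [this]
    exact convex_ball z r ha hb hp hq hpq
  have hφ : DifferentiableOn ℂ (fun t => g (L t)) U :=
    (hg.mono hrD).comp hLd.differentiableOn fun t ht => ht
  have h0U : (0 : ℂ) ∈ U := by simpa [hU, hL] using hsz
  have h1U : (1 : ℂ) ∈ U := by simpa [hU, hL] using hw
  have hev : (fun t => g (L t)) =ᶠ[𝓝 0] 0 := by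
    have : Tendsto L (𝓝 0) (𝓝 s) := by
      simpa [hL] using hLd.continuous.tendsto 0
    exact this.eventually hs
  have := (hφ.analyticOnNhd hUo).eqOn_zero_of_preconnected_of_eventuallyEq_zero
    hUc.isPreconnected h0U hev h1U
  simpa [hL] using this

end SeveralVariables

/-! ### Holomorphy of derivatives and of uniform limits on `ℂⁿ`. -/

section Coordinates

variable {n : ℕ}

/-- Directional derivatives of holomorphic functions are holomorphic. -/
theorem differentiableOn_fderiv_apply {g : (Fin n → ℂ) → ℂ} {D : Set (Fin n → ℂ)} (hD : IsOpen D)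
    (hg : DifferentiableOn ℂ g D) (v : Fin n → ℂ) :
    DifferentiableOn ℂ (fun z => fderiv ℂ g z v) D := by
  intro w hw
  refine DifferentiableAt.differentiableWithinAt ?_
  obtain ⟨r, hr, M, hrD, hM⟩ := exists_ball_bounded hD hg hw
  -- Base points range over radius `ρ` and displacements along the circle have norm at most `ρ`;
  -- Cauchy's estimate on balls of radius `2 * ρ` about the displaced points then stays within `4 *
  -- ρ = r`.
  set ρ := r / 4 with hρ
  have hρ0 : 0 < ρ := by positivity
  set s := ρ / (‖v‖ + 1) with hs
  have hs0 : 0 < s := by positivity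
  have hsv : s * ‖v‖ ≤ ρ := by
    rw [hs, div_mul_eq_mul_div, div_le_iff₀ (by positivity)]
    nlinarith [norm_nonneg v]
  have hcm : ∀ θ, ‖circleMap 0 s θ • v‖ ≤ ρ := fun θ => by
    rw [norm_smul, norm_circleMap_zero, abs_of_pos hs0]; exact hsv
  have hin : ∀ z ∈ ball w ρ, ∀ t ∈ closedBall (0 : ℂ) s, z + t • v ∈ ball w (2 * ρ) := by
    intro z hz t ht
    rw [mem_closedBall_zero_iff] at ht
    rw [mem_ball, dist_eq_norm] at hz ⊢
    calc ‖z + t • v - w‖ = ‖(z - w) + t • v‖ := by congr 1; abel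
      _ ≤ ‖z - w‖ + ‖t‖ * ‖v‖ := by rw [← norm_smul]; exact norm_add_le _ _
      _ < 2 * ρ := by nlinarith [mul_le_mul_of_nonneg_right ht (norm_nonneg v)]
  have hsub : ball w (2 * ρ) ⊆ D := (ball_subset_ball (by linarith)).trans hrD
  have hin' : ∀ z ∈ ball w ρ, ∀ θ, z + circleMap 0 s θ • v ∈ ball w (2 * ρ) := fun z hz θ =>
    hin z hz _ (by simp [abs_of_pos hs0])
  have hda : ∀ z ∈ ball w (2 * ρ), DifferentiableAt ℂ g z := fun z hz =>
    hg.differentiableAt (hD.mem_nhds (hsub hz))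
  set κ : ℝ → ℂ := fun θ => deriv (circleMap 0 s) θ * ((circleMap 0 s θ) ^ 2)⁻¹ with hκ
  have hκc : Continuous κ := by
    have h1 : ∀ θ, (circleMap 0 s θ) ^ 2 ≠ 0 := fun θ =>
      pow_ne_zero _ (circleMap_ne_center hs0.ne')
    have h2 : Continuous fun θ => deriv (circleMap 0 s) θ := by
      simp only [deriv_circleMap]; fun_prop
    exact h2.mul (((continuous_circleMap 0 s).pow 2).inv₀ h1)
  -- Cauchy's formula writes the derivative as an integral of values of `g`, so it can be
  -- differentiated in `z` under the integral sign.
  have hCauchy : ∀ z ∈ ball w ρ, fderiv ℂ g z v =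
      (2 * Real.pi * Complex.I)⁻¹ •
        ∫ θ in (0 : ℝ)..2 * Real.pi, κ θ * g (z + circleMap 0 s θ • v) := by
    intro z hz
    set U : Set ℂ := (fun t : ℂ => z + t • v) ⁻¹' ball w (2 * ρ)
    have hUo : IsOpen U := isOpen_ball.preimage (by fun_prop)
    have hφ : DifferentiableOn ℂ (fun t : ℂ => g (z + t • v)) U :=
      (hg.mono hsub).comp (by fun_prop) fun t ht => ht
    have h1 := Complex.two_pi_I_inv_smul_circleIntegral_sub_sq_inv_smul_of_differentiable
      hUo (c := 0) (w₀ := 0) (R := s) (fun t ht => hin z hz t ht) hφ (by simpa using hs0)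
    have h0 : HasDerivAt (fun t : ℂ => g (z + t • v)) (fderiv ℂ g z v) 0 := by
      have h1 : HasFDerivAt g (fderiv ℂ g z) (z + (0 : ℂ) • v) := by
        simpa using (hda z (ball_subset_ball (by linarith) hz)).hasFDerivAt
      have h2 : HasDerivAt (fun t : ℂ => z + t • v) v 0 := by
        simpa using ((hasDerivAt_id (0 : ℂ)).smul_const v).const_add z
      exact h1.comp_hasDerivAt _ h2
    rw [h0.deriv] at h1
    rw [← h1, circleIntegral]
    simp only [hκ, smul_eq_mul, sub_zero, mul_assoc]
  have hM0 : 0 ≤ M := (norm_nonneg _).trans (hM w (mem_ball_self hr))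
  have hbound : ∀ z ∈ ball w (2 * ρ), ‖fderiv ℂ g z‖ ≤ 2 * M / (2 * ρ) := by
    intro z hz
    have hzs : ball z (2 * ρ) ⊆ ball w r := by
      refine ball_subset_ball' ?_
      rw [mem_ball] at hz
      linarith
    exact norm_fderiv_le_of_bounded_on_ball (by positivity) (hg.mono (hzs.trans hrD))
      fun y hy => hM y (hzs hy)
  have hmain : HasFDerivAt (fun z => ∫ θ in (0 : ℝ)..2 * Real.pi,
      κ θ * g (z + circleMap 0 s θ • v)) (∫ θ in (0 : ℝ)..2 * Real.pi,
      κ θ • fderiv ℂ g (w + circleMap 0 s θ • v)) w := by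
    have hFc : ∀ z ∈ ball w ρ, Continuous fun θ => κ θ * g (z + circleMap 0 s θ • v) := by
      intro z hz
      refine hκc.mul ((hg.mono hsub).continuousOn.comp_continuous ?_ (hin' z hz))
      exact continuous_const.add ((continuous_circleMap 0 s).smul continuous_const)
    refine intervalIntegral.hasFDerivAt_integral_of_dominated_of_fderiv_le
      (F' := fun z θ => κ θ • fderiv ℂ g (z + circleMap 0 s θ • v))
      (bound := fun θ => ‖κ θ‖ * (2 * M / (2 * ρ)))
      (ball_mem_nhds w hρ0) ?_ ?_ ?_ ?_ ?_ ?_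
    · filter_upwards [ball_mem_nhds w hρ0] with z hz
      exact (hFc z hz).aestronglyMeasurable
    · exact (hFc w (mem_ball_self hρ0)).intervalIntegrable _ _
    · refine AEStronglyMeasurable.smul hκc.aestronglyMeasurable ?_
      refine Measurable.aestronglyMeasurable ?_
      exact (measurable_fderiv ℂ g).comp (continuous_const.add
        ((continuous_circleMap 0 s).smul continuous_const)).measurable
    · refine Eventually.of_forall fun θ _ z hz => ?_
      rw [norm_smul]
      gcongr
      exact hbound _ (hin' z hz θ)
    · exact (hκc.norm.mul continuous_const).intervalIntegrable _ _
    · refine Eventually.of_forall fun θ _ z hz => ?_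
      have h1 := (hda _ (hin' z hz θ)).hasFDerivAt
      exact (h1.comp z ((hasFDerivAt_id z).add_const _)).const_mul (κ θ)
  have h2 := (hmain.const_smul (2 * Real.pi * Complex.I : ℂ)⁻¹).differentiableAt
  refine h2.congr_of_eventuallyEq ?_
  filter_upwards [ball_mem_nhds w hρ0] with z hz
  exact hCauchy z hz

/-- Uniform limits of holomorphic functions are holomorphic. -/
theorem differentiableAt_of_tendstoUniformlyOn_ball {F : ℕ → (Fin n → ℂ) → ℂ}
    {G : (Fin n → ℂ) → ℂ} {w : Fin n → ℂ} {r : ℝ} (hr : 0 < r)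
    (hF : ∀ k, DifferentiableOn ℂ (F k) (ball w r))
    (hG : TendstoUniformlyOn F G atTop (ball w r)) : DifferentiableAt ℂ G w := by
  have hball : ∀ z ∈ ball w (r / 2), ball z (r / 2) ⊆ ball w r := fun z hz => by
    refine ball_subset_ball' ?_
    rw [mem_ball] at hz
    linarith
  have hda : ∀ k, ∀ z ∈ ball w (r / 2), DifferentiableAt ℂ (F k) z := fun k z hz =>
    (hF k).differentiableAt
      (isOpen_ball.mem_nhds (hball z hz (mem_ball_self (by positivity))))
  have hcau : UniformCauchySeqOn (fun k z => fderiv ℂ (F k) z) atTop (ball w (r / 2)) := by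
    rw [Metric.uniformCauchySeqOn_iff]
    intro ε hε
    -- Cauchy's estimate on balls of radius `r / 2` turns `ε * r / 8` into `ε / 2`.
    obtain ⟨N, hN⟩ := Metric.uniformCauchySeqOn_iff.1 hG.uniformCauchySeqOn (ε * r / 8)
      (by positivity)
    refine ⟨N, fun k hk l hl z hz => ?_⟩
    rw [dist_eq_norm, ← fderiv_sub (hda k z hz) (hda l z hz)]
    have h1 := norm_fderiv_le_of_bounded_on_ball (g := F k - F l) (z := z) (r := r / 2)
      (M := ε * r / 8) (by positivity)
      (((hF k).sub (hF l)).mono (hball z hz)) (fun y hy => by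
        rw [Pi.sub_apply, ← dist_eq_norm]
        exact (hN k hk l hl y (hball z hz hy)).le)
    refine h1.trans_lt ?_
    rw [div_lt_iff₀ (by positivity)]
    nlinarith [mul_pos hε hr]
  have hex : ∀ z ∈ ball w (r / 2), ∃ L, Tendsto (fun k => fderiv ℂ (F k) z) atTop (𝓝 L) :=
    fun z hz => cauchySeq_tendsto_of_complete (hcau.cauchySeq hz)
  choose! G' hG' using hex
  exact (hasFDerivAt_of_tendstoUniformlyOn isOpen_ball
    (hcau.tendstoUniformlyOn_of_tendsto hG') (fun k z hz => (hda k z hz).hasFDerivAt)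
    (fun z hz => hG.tendsto_at (ball_subset_ball (by linarith) hz))
    (mem_ball_self (by positivity : 0 < r / 2))).differentiableAt

end Coordinates

/-! ### Semi-invariant holomorphic functions -/

section SemiInvariant

variable {n r : ℕ} {m : Fin n → Fin r → ℤ}

/-- The character of the torus with weight `M`. -/
def weightChar (M : Fin r → ℤ) (lam : Fin r → Circle) : Circle := ∏ j, lam j ^ M j

/-- The exponents of the monomials of weight `M`. -/
def weightSet (m : Fin n → Fin r → ℤ) (M : Fin r → ℤ) : Set (Fin n → ℕ) :=
  {α | ∀ j, ∑ k, (α k : ℤ) * m k j = M j}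

/-- `g` is semi-invariant of weight `M` on `S`. -/
def IsSemiInvariantOn (m : Fin n → Fin r → ℤ) (M : Fin r → ℤ) (g : (Fin n → ℂ) → ℂ)
    (S : Set (Fin n → ℂ)) : Prop :=
  ∀ (lam : Fin r → Circle), ∀ z ∈ S, g (torusAction m lam z) = weightChar M lam * g z

theorem torusAction_apply (lam : Fin r → Circle) (z : Fin n → ℂ) (i : Fin n) :
    torusAction m lam z i = weightChar (m i) lam * z i := rfl

theorem weightChar_sub (M N : Fin r → ℤ) (lam : Fin r → Circle) :
    weightChar (M - N) lam = weightChar M lam / weightChar N lam := by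
  simp [weightChar, zpow_sub, div_eq_mul_inv, Finset.prod_mul_distrib]

theorem weightChar_zero (lam : Fin r → Circle) : weightChar 0 lam = 1 := by
  simp [weightChar]

theorem exists_weightChar_ne_one {M : Fin r → ℤ} (hM : M ≠ 0) : ∃ lam, weightChar M lam ≠ 1 := by
  obtain ⟨j, hj⟩ := Function.ne_iff.1 hM
  rw [Pi.zero_apply] at hj
  -- The character takes the value `exp(iπ) = -1` at this point.
  refine ⟨Pi.mulSingle j (Circle.exp (Real.pi / M j)), ?_⟩
  have h1 : weightChar M (Pi.mulSingle j (Circle.exp (Real.pi / M j))) =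
      Circle.exp (Real.pi / M j) ^ M j := by
    rw [weightChar, Finset.prod_eq_single j]
    · simp
    · intro k _ hk
      simp [Pi.mulSingle_eq_of_ne hk]
    · simp
  have hj' : (M j : ℝ) ≠ 0 := by exact_mod_cast hj
  rw [h1, ← Circle.exp_intCast_mul, mul_div_cancel₀ _ hj']
  intro h
  have := congrArg (fun c : Circle => (c : ℂ)) h
  simp [Circle.coe_exp, Complex.exp_pi_mul_I] at this
  norm_num at this

/-- The torus action by `lam` as a continuous linear map. -/
def torusCLM (m : Fin n → Fin r → ℤ) (lam : Fin r → Circle) : (Fin n → ℂ) →L[ℂ] (Fin n → ℂ) :=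
  ContinuousLinearMap.pi fun i => (weightChar (m i) lam : ℂ) • ContinuousLinearMap.proj i

theorem torusCLM_apply (lam : Fin r → Circle) (z : Fin n → ℂ) :
    torusCLM m lam z = torusAction m lam z := by
  ext i; simp [torusCLM, torusAction_apply]

theorem norm_torusAction (lam : Fin r → Circle) (z : Fin n → ℂ) :
    ‖torusAction m lam z‖ = ‖z‖ := by
  have h : ∀ c : Circle, ‖(c : ℂ)‖₊ = 1 := fun c => NNReal.eq (Circle.norm_coe c)
  simp [Pi.norm_def, torusAction_apply, nnnorm_mul, h]

theorem torusAction_mem_ball {lam : Fin r → Circle} {z : Fin n → ℂ} {ε : ℝ}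
    (hz : z ∈ ball (0 : Fin n → ℂ) ε) : torusAction m lam z ∈ ball (0 : Fin n → ℂ) ε := by
  simpa [norm_torusAction] using hz

theorem torusAction_inv (lam : Fin r → Circle) (z : Fin n → ℂ) :
    torusAction m lam⁻¹ (torusAction m lam z) = z := by
  ext i
  simp only [torusAction, ← mul_assoc, ← Circle.coe_mul, ← Finset.prod_mul_distrib]
  simp

theorem torusAction_single (lam : Fin r → Circle) (k : Fin n) (c : ℂ) :
    torusAction m lam (Pi.single k c) = Pi.single k ((weightChar (m k) lam : ℂ) * c) := by
  ext i
  rw [torusAction_apply]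
  rcases eq_or_ne i k with rfl | h <;> simp [*]

/-- Differentiating `g ∘ ρ(lam) = lam^M g` in direction `k` produces a factor `lam^{m_k}` on the
left, which lowers the weight by `m_k`. -/
theorem IsSemiInvariantOn.fderiv_single {M : Fin r → ℤ} {g : (Fin n → ℂ) → ℂ}
    {D : Set (Fin n → ℂ)} (hD : IsOpen D) (hD' : ∀ lam, ∀ z ∈ D, torusAction m lam z ∈ D)
    (hg : DifferentiableOn ℂ g D) (h : IsSemiInvariantOn m M g D) (k : Fin n) :
    IsSemiInvariantOn m (M - m k) (fun z => fderiv ℂ g z (Pi.single k 1)) D := by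
  intro lam z hz
  have h1 : HasFDerivAt (fun w => g (torusAction m lam w))
      ((fderiv ℂ g (torusAction m lam z)).comp (torusCLM m lam)) z := by
    have h2 := (hg.differentiableAt (hD.mem_nhds (hD' lam z hz))).hasFDerivAt
    rw [← torusCLM_apply] at h2
    have := h2.comp z (torusCLM m lam).hasFDerivAt
    simpa [Function.comp_def, torusCLM_apply] using this
  have h2 : HasFDerivAt (fun w => g (torusAction m lam w))
      ((weightChar M lam : ℂ) • fderiv ℂ g z) z := by
    have := (hg.differentiableAt (hD.mem_nhds hz)).hasFDerivAt.const_mul (weightChar M lam : ℂ)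
    refine this.congr_of_eventuallyEq ?_
    filter_upwards [hD.mem_nhds hz] with w hw
    exact h lam w hw
  have h3 := DFunLike.congr_fun (h1.unique h2) (Pi.single k 1)
  rw [ContinuousLinearMap.comp_apply, torusCLM_apply, torusAction_single, mul_one,
    ← mul_one (weightChar (m k) lam : ℂ), ← smul_eq_mul, Pi.single_smul, map_smul] at h3
  rw [weightChar_sub, Circle.coe_div, div_mul_eq_mul_div, eq_div_iff (Circle.coe_ne_zero _),
    mul_comm]
  simpa using h3

theorem prod_zpow_eq_zpow_sum {ι G : Type*} [CommGroup G] (s : Finset ι) (a : G) (e : ι → ℤ) :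
    ∏ i ∈ s, a ^ e i = a ^ ∑ i ∈ s, e i := by
  classical
  induction s using Finset.induction_on with
  | empty => simp
  | insert i s hi ih => rw [Finset.prod_insert hi, Finset.sum_insert hi, zpow_add, ih]

/-- The monomial `z^α` would be a nonconstant invariant: it is `1` at `(1, …, 1)` and `0` at the
origin. -/
theorem OnlyConstantInvariants.eq_zero (h : OnlyConstantInvariants m) {α : Fin n → ℕ}
    (hα : α ∈ weightSet m 0) : α = 0 := by
  by_contra hne
  obtain ⟨k, hk⟩ := Function.ne_iff.1 hne
  have h1 := h (fun z => ∏ i, z i ^ α i) (by fun_prop) (fun lam z => by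
    simp only [torusAction_apply, mul_pow, Finset.prod_mul_distrib]
    convert one_mul _
    have : ∏ i, weightChar (m i) lam ^ α i = 1 := by
      simp only [weightChar, ← Finset.prod_pow]
      rw [Finset.prod_comm]
      refine Finset.prod_eq_one fun j _ => ?_
      have := hα j
      simp only [← zpow_natCast, ← zpow_mul]
      rw [Finset.prod_congr rfl fun k _ => by rw [mul_comm (m k j)],
        prod_zpow_eq_zpow_sum, this, Pi.zero_apply, zpow_zero]
    have h2 := congrArg Circle.coeHom this
    rw [map_prod, map_one] at h2
    exact h2) 1 0
  simp only [Pi.one_apply, one_pow, Finset.prod_const_one, Pi.zero_apply] at h1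
  rw [Finset.prod_eq_zero (Finset.mem_univ k) (zero_pow hk)] at h1
  exact one_ne_zero h1

/-- If `α ≤ β` have the same weight, then `β - α` has weight zero and so vanishes. The exponents
thus form an antichain in `ℕⁿ`, finite by Dickson's lemma. -/
theorem OnlyConstantInvariants.finite_weightSet (h : OnlyConstantInvariants m) (M : Fin r → ℤ) :
    (weightSet m M).Finite := by
  have hanti : IsAntichain (· ≤ ·) (weightSet m M) := by
    intro α hα β hβ hne hle
    have : β - α = 0 := h.eq_zero fun j => by
      have h1 : ∀ k, ((β - α) k : ℤ) = β k - α k := fun k => by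
        rw [Pi.sub_apply, Nat.cast_sub (hle k)]
      simp only [h1, sub_mul, Finset.sum_sub_distrib, hα j, hβ j, sub_self, Pi.zero_apply]
    exact hne (le_antisymm hle (tsub_eq_zero_iff_le.1 this))
  exact WellQuasiOrderedLE.finite_of_isAntichain hanti

theorem differentiable_mvPolynomial_eval (P : MvPolynomial (Fin n) ℂ) :
    Differentiable ℂ fun z : Fin n → ℂ => MvPolynomial.eval z P := by
  simp only [MvPolynomial.eval_eq']
  fun_prop

theorem clm_apply_eq_sum (L : (Fin n → ℂ) →L[ℂ] ℂ) (z : Fin n → ℂ) :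
    L z = ∑ k, z k * L (Pi.single k 1) := by
  have h : z = ∑ k, z k • (Pi.single k (1 : ℂ) : Fin n → ℂ) := by
    ext i
    simp [Finset.sum_apply, Pi.single_apply]
  conv_lhs => rw [h, map_sum]
  simp

/-- The homogeneous parts of the Taylor series at `0` of a semi-invariant holomorphic function are
polynomials with semi-invariant monomials. -/
theorem exists_homogeneous_part {ε : ℝ} (hε : 0 < ε) (N : ℕ) :
    ∀ (M : Fin r → ℤ) (g : (Fin n → ℂ) → ℂ), DifferentiableOn ℂ g (ball 0 ε) →
      IsSemiInvariantOn m M g (ball 0 ε) →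
      ∃ P : MvPolynomial (Fin n) ℂ, (∀ α ∈ P.support, ⇑α ∈ weightSet m M ∧ ∑ k, α k = N) ∧
        ∀ z, iteratedDeriv N (fun t : ℂ => g (t • z)) 0 = MvPolynomial.eval z P := by
  induction N with
  | zero =>
    intro M g hg hgM
    refine ⟨MvPolynomial.C (g 0), fun α hα => ?_, fun z => by simp⟩
    rw [MvPolynomial.mem_support_iff, MvPolynomial.coeff_C] at hα
    have hα0 : 0 = α := by by_contra h; simp [h] at hα
    subst hα0
    rw [if_pos rfl] at hα
    refine ⟨?_, by simp⟩
    -- Here `g 0 ≠ 0`, and evaluating semi-invariance at the fixed point `0` gives `g 0 = lam^M g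
    -- 0`.
    have hM : M = 0 := by
      by_contra hM
      obtain ⟨lam, hlam⟩ := exists_weightChar_ne_one hM
      have h1 := hgM lam 0 (mem_ball_self hε)
      have h2 : torusAction m lam 0 = 0 := by rw [← torusCLM_apply, map_zero]
      rw [h2] at h1
      have h3 : (weightChar M lam : ℂ) = 1 := by
        field_simp at h1
        exact h1.symm
      exact hlam (Circle.ext h3)
    intro j
    simp [hM]
  | succ N ih =>
    intro M g hg hgM
    have hpart : ∀ k, ∃ P : MvPolynomial (Fin n) ℂ,
        (∀ α ∈ P.support, ⇑α ∈ weightSet m (M - m k) ∧ ∑ k, α k = N) ∧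
        ∀ z, iteratedDeriv N (fun t : ℂ => fderiv ℂ g (t • z) (Pi.single k 1)) 0 =
          MvPolynomial.eval z P := fun k =>
      ih _ _ (differentiableOn_fderiv_apply isOpen_ball hg _)
        (hgM.fderiv_single isOpen_ball (fun lam z hz => torusAction_mem_ball hz) hg k)
    choose P hP hPe using hpart
    -- The derivative of `g(tz)` in `t` is `∑ z_k ∂_k g(tz)`; the factor `z_k` restores the weight
    -- `m_k` lost in `∂_k g`.
    refine ⟨∑ k, MvPolynomial.X k * P k, fun α hα => ?_, fun z => ?_⟩
    · obtain ⟨k, -, hk⟩ := Finset.mem_biUnion.1 (MvPolynomial.support_sum hα)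
      rw [MvPolynomial.support_X_mul, Finset.mem_map] at hk
      obtain ⟨β, hβ, rfl⟩ := hk
      obtain ⟨h1, h2⟩ := hP k β hβ
      constructor
      · intro j
        have := h1 j
        simp only [addLeftEmbedding_apply, Finsupp.coe_add, Pi.add_apply, Nat.cast_add, add_mul,
          Finset.sum_add_distrib, this]
        rw [Finset.sum_eq_single k] <;> simp +contextual [eq_comm]
      · simp only [addLeftEmbedding_apply, Finsupp.coe_add, Pi.add_apply,
          Finset.sum_add_distrib, h2]
        rw [Finset.sum_eq_single k] <;> simp +contextual [eq_comm, add_comm]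
    · have hU : IsOpen ((fun t : ℂ => t • z) ⁻¹' ball 0 ε) := isOpen_ball.preimage (by fun_prop)
      have h0U : (0 : ℂ) ∈ (fun t : ℂ => t • z) ⁻¹' ball 0 ε := by simpa using hε
      have hder : deriv (fun t : ℂ => g (t • z)) =ᶠ[𝓝 0]
          fun t => ∑ k, z k * fderiv ℂ g (t • z) (Pi.single k 1) := by
        filter_upwards [hU.mem_nhds h0U] with t ht
        have h1 := (hg.differentiableAt (isOpen_ball.mem_nhds ht)).hasFDerivAt
        have h2 : HasDerivAt (fun t : ℂ => t • z) z t := by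
          simpa using (hasDerivAt_id t).smul_const z
        refine (h1.comp_hasDerivAt t h2).deriv.trans ?_
        exact clm_apply_eq_sum _ z
      rw [iteratedDeriv_succ', hder.iteratedDeriv_eq]
      have hcd : ∀ k, ContDiffAt ℂ N (fun t : ℂ => fderiv ℂ g (t • z) (Pi.single k 1)) 0 := by
        intro k
        have h1 : DifferentiableOn ℂ (fun t : ℂ => fderiv ℂ g (t • z) (Pi.single k 1))
            ((fun t : ℂ => t • z) ⁻¹' ball 0 ε) :=
          (differentiableOn_fderiv_apply isOpen_ball hg (Pi.single k 1)).comp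
            (by fun_prop) fun t ht => ht
        exact (h1.analyticAt (hU.mem_nhds h0U)).contDiffAt
      rw [iteratedDeriv_fun_sum fun k _ => contDiffAt_const.mul (hcd k)]
      simp only [map_sum, map_mul, MvPolynomial.eval_X, ← hPe]
      exact Finset.sum_congr rfl fun k _ => iteratedDeriv_const_mul_field _ _

/-- Near the origin a semi-invariant holomorphic function is a polynomial with semi-invariant
monomials. -/
theorem IsSemiInvariantOn.exists_polynomial_ball (hm : OnlyConstantInvariants m) {ε : ℝ}
    (hε : 0 < ε) {M : Fin r → ℤ} {g : (Fin n → ℂ) → ℂ} (hg : DifferentiableOn ℂ g (ball 0 ε))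
    (h : IsSemiInvariantOn m M g (ball 0 ε)) :
    ∃ P : MvPolynomial (Fin n) ℂ, (∀ α ∈ P.support, ⇑α ∈ weightSet m M) ∧
      ∀ z ∈ ball (0 : Fin n → ℂ) ε, g z = MvPolynomial.eval z P := by
  choose P hP hPe using fun N => exists_homogeneous_part hε N M g hg h
  obtain ⟨d, hd⟩ := ((hm.finite_weightSet M).image fun α => ∑ k, α k).bddAbove
  have hP0 : ∀ N, N ∉ Finset.range (d + 1) → P N = 0 := by
    intro N hN
    by_contra hne
    obtain ⟨α, hα⟩ := MvPolynomial.ne_zero_iff.1 hne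
    obtain ⟨h1, h2⟩ := hP N α (MvPolynomial.mem_support_iff.2 hα)
    have := hd ⟨_, h1, rfl⟩
    simp only [h2] at this
    exact hN (Finset.mem_range.2 (by omega))
  refine ⟨∑ N ∈ Finset.range (d + 1), MvPolynomial.C ((N.factorial : ℂ)⁻¹) * P N,
    fun α hα => ?_, fun z hz => ?_⟩
  · obtain ⟨N, -, hN⟩ := Finset.mem_biUnion.1 (MvPolynomial.support_sum hα)
    rw [MvPolynomial.mem_support_iff, MvPolynomial.coeff_C_mul] at hN
    exact (hP N α (MvPolynomial.mem_support_iff.2 (right_ne_zero_of_mul hN))).1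
  · rw [mem_ball_zero_iff] at hz
    -- A radius `R > 1` with `R * ‖z‖ < ε`, so that the Taylor series of `t ↦ g(tz)` can be
    -- evaluated at `t = 1`.
    set R := 1 + (ε - ‖z‖) / (2 * ε) with hR
    have hR1 : 1 < R := by
      have : 0 < (ε - ‖z‖) / (2 * ε) := div_pos (by linarith) (by linarith)
      linarith
    have hRz : R * ‖z‖ < ε := by
      have h1 : (ε - ‖z‖) / (2 * ε) * ‖z‖ ≤ (ε - ‖z‖) / 2 := by
        rw [div_mul_eq_mul_div, div_le_div_iff₀ (by positivity) (by norm_num)]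
        nlinarith [norm_nonneg z, mul_nonneg (sub_nonneg.2 hz.le) (sub_nonneg.2 hz.le)]
      rw [hR, add_mul, one_mul]
      linarith
    have hφ : DifferentiableOn ℂ (fun t : ℂ => g (t • z)) (ball 0 R) := by
      refine hg.comp (by fun_prop) fun t ht => ?_
      rw [mem_ball_zero_iff] at ht ⊢
      rw [norm_smul]
      nlinarith [norm_nonneg z, mul_le_mul_of_nonneg_right ht.le (norm_nonneg z)]
    have h1 := Complex.hasSum_taylorSeries_on_ball hφ (z := 1) (by simpa using hR1)
    simp only [hPe, sub_zero, one_pow, one_smul, smul_eq_mul, one_mul] at h1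
    have h2 := hasSum_sum_of_ne_finset_zero (L := SummationFilter.unconditional ℕ)
      (f := fun N => ((N.factorial : ℂ)⁻¹) * MvPolynomial.eval z (P N)) fun N hN => by
        rw [hP0 N hN]; simp
    rw [h1.unique h2]
    simp

/-- On an invariant domain a semi-invariant holomorphic function is a polynomial with semi-invariant
monomials. -/
theorem IsSemiInvariantOn.exists_polynomial (hm : OnlyConstantInvariants m)
    {D : Set (Fin n → ℂ)} (hD : IsOpen D) (hc : IsPreconnected D) (h0 : 0 ∈ D)
    {M : Fin r → ℤ} {g : (Fin n → ℂ) → ℂ} (hg : DifferentiableOn ℂ g D)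
    (h : IsSemiInvariantOn m M g D) :
    ∃ P : MvPolynomial (Fin n) ℂ, (∀ α ∈ P.support, ⇑α ∈ weightSet m M) ∧
      ∀ z ∈ D, g z = MvPolynomial.eval z P := by
  obtain ⟨ε, hε, hεD⟩ := Metric.isOpen_iff.1 hD 0 h0
  obtain ⟨P, hP, hPe⟩ := IsSemiInvariantOn.exists_polynomial_ball hm hε (hg.mono hεD)
    fun lam z hz => h lam z (hεD hz)
  refine ⟨P, hP, fun z hz => sub_eq_zero.1 ?_⟩
  refine eqOn_zero_of_eventuallyEq_zero (g := fun z => g z - MvPolynomial.eval z P) hD hc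
    (hg.sub (differentiable_mvPolynomial_eval P).differentiableOn) h0 ?_ z hz
  filter_upwards [ball_mem_nhds _ hε] with w hw
  simp [hPe w hw]

/-- A holomorphic invariant function is constant. -/
theorem IsSemiInvariantOn.eq_const (hm : OnlyConstantInvariants m)
    {D : Set (Fin n → ℂ)} (hD : IsOpen D) (hc : IsPreconnected D) (h0 : 0 ∈ D)
    {g : (Fin n → ℂ) → ℂ} (hg : DifferentiableOn ℂ g D)
    (h : IsSemiInvariantOn m 0 g D) {z : Fin n → ℂ} (hz : z ∈ D) : g z = g 0 := by
  obtain ⟨P, hP, hPe⟩ := h.exists_polynomial hm hD hc h0 hg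
  have : P = MvPolynomial.C (P.coeff 0) := by
    ext α
    rw [MvPolynomial.coeff_C]
    split_ifs with hα
    · rw [hα]
    · by_contra hne
      have h1 := hm.eq_zero (hP α (MvPolynomial.mem_support_iff.2 hne))
      exact hα (DFunLike.coe_injective h1).symm
  rw [hPe z hz, hPe 0 h0, this]
  simp

/-- Finiteness of the resonance set is essential: the `sSup` of an unbounded set of natural numbers
is `0`. -/
theorem totalDegree_le_resonanceOrder (hm : OnlyConstantInvariants m) {i : Fin n}
    {P : MvPolynomial (Fin n) ℂ} (hP : ∀ α ∈ P.support, ⇑α ∈ weightSet m (m i)) :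
    P.totalDegree ≤ resonanceOrder m := by
  refine le_trans ?_ (Finset.le_sup (f := resonanceOrderAt m) (Finset.mem_univ i))
  rw [MvPolynomial.totalDegree]
  refine Finset.sup_le fun α hα => ?_
  rw [Finsupp.sum_fintype _ _ fun _ => rfl]
  exact le_csSup ((hm.finite_weightSet (m i)).image fun α => ∑ k, α k).bddAbove
    ⟨α, hP α hα, rfl⟩

end SemiInvariant

/-! ### The Bergman space -/

section BergmanSpace

variable {n : ℕ} {D : Set (Fin n → ℂ)}

theorem measurePreserving_smul_of_norm_eq_one {c : ℂ} (hc : ‖c‖ = 1) :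
    MeasurePreserving (fun v : Fin n → ℂ => c • v) volume volume := by
  set a : Circle := ⟨c, mem_sphere_zero_iff_norm.2 hc⟩
  exact volume_preserving_pi (f := fun _ : Fin n => fun t : ℂ => rotation a t) fun _ =>
    (rotation a).measurePreserving

theorem setIntegral_ball_smul {c : ℂ} (hc : ‖c‖ = 1) (G : (Fin n → ℂ) → ℂ) (δ : ℝ) :
    ∫ v in ball 0 δ, G (c • v) = ∫ v in ball 0 δ, G v := by
  have hc0 : c ≠ 0 := norm_ne_zero_iff.1 (by rw [hc]; exact one_ne_zero)
  have h := (measurePreserving_smul_of_norm_eq_one (n := n) hc).setIntegral_preimage_emb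
    (Homeomorph.smulOfNeZero c hc0).measurableEmbedding G (ball 0 δ)
  have hpre : (fun v : Fin n → ℂ => c • v) ⁻¹' ball 0 δ = ball 0 δ := by
    ext v; simp [norm_smul, hc]
  rwa [hpre] at h

/-- The mean value property of holomorphic functions. -/
theorem setIntegral_ball_eq {g : (Fin n → ℂ) → ℂ} (hD : IsOpen D) (hg : DifferentiableOn ℂ g D)
    {z : Fin n → ℂ} {δ : ℝ} (hz : closedBall z δ ⊆ D) :
    ∫ y in ball z δ, g y = (volume (ball z δ)).toReal * g z := by
  have hshift : ∫ v in ball (0 : Fin n → ℂ) δ, g (z + v) = ∫ y in ball z δ, g y := by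
    have h := (measurePreserving_add_left volume z).setIntegral_preimage_emb
      (Homeomorph.addLeft z).measurableEmbedding g (ball z δ)
    have hpre : (fun v : Fin n → ℂ => z + v) ⁻¹' ball z δ = ball 0 δ := by
      ext v; simp [dist_eq_norm]
    rwa [hpre] at h
  have hvol : volume (ball z δ) = volume (ball (0 : Fin n → ℂ) δ) :=
    Measure.addHaar_ball_center _ _ _
  have hmem : ∀ (θ : ℝ), ∀ v ∈ closedBall (0 : Fin n → ℂ) δ, z + circleMap 0 1 θ • v ∈ D := by
    intro θ v hv
    apply hz
    rw [mem_closedBall_zero_iff] at hv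
    simpa [dist_eq_norm, norm_smul] using hv
  -- The mean value property is used on the circle `z + e^{iθ} v` for fixed `v`, then integrated
  -- over `v`.
  have hcircle : ∀ v ∈ ball (0 : Fin n → ℂ) δ,
      ∫ θ in Ioc 0 (2 * Real.pi), g (z + circleMap 0 1 θ • v) = 2 * Real.pi * g z := by
    intro v hv
    set U : Set ℂ := (fun t : ℂ => z + t • v) ⁻¹' D
    have hUo : IsOpen U := hD.preimage (by fun_prop)
    have hU : closedBall (0 : ℂ) 1 ⊆ U := by
      intro t ht
      apply hz
      rw [mem_closedBall_zero_iff] at ht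
      rw [mem_ball_zero_iff] at hv
      rw [mem_closedBall, dist_eq_norm, add_sub_cancel_left, norm_smul]
      nlinarith [norm_nonneg v, mul_le_mul_of_nonneg_right ht (norm_nonneg v)]
    have hφ : DifferentiableOn ℂ (fun t : ℂ => g (z + t • v)) U :=
      hg.comp (by fun_prop) fun t ht => ht
    have h1 := (hφ.diffContOnCl_ball hU)
    have h2 := DiffContOnCl.circleAverage (f := fun t : ℂ => g (z + t • v)) (c := 0) (R := 1)
      (by rwa [abs_one])
    rw [Real.circleAverage, intervalIntegral.integral_of_le (by positivity)] at h2
    simp only [zero_smul, add_zero] at h2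
    rw [← h2, Complex.real_smul]
    push_cast
    field_simp
  have hint : Integrable (Function.uncurry fun (θ : ℝ) (v : Fin n → ℂ) =>
      g (z + circleMap 0 1 θ • v)) ((volume.restrict (Ioc 0 (2 * Real.pi))).prod
        (volume.restrict (ball 0 δ))) := by
    rw [Measure.prod_restrict]
    have h1 : ContinuousOn (Function.uncurry fun (θ : ℝ) (v : Fin n → ℂ) =>
        g (z + circleMap 0 1 θ • v)) (Icc 0 (2 * Real.pi) ×ˢ closedBall 0 δ) := by
      refine hg.continuousOn.comp (Continuous.continuousOn ?_) fun p hp => hmem _ _ hp.2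
      exact continuous_const.add
        (((continuous_circleMap 0 1).comp continuous_fst).smul continuous_snd)
    have h2 : IntegrableOn _ _ ((volume : Measure ℝ).prod (volume : Measure (Fin n → ℂ))) :=
      h1.integrableOn_compact (isCompact_Icc.prod (isCompact_closedBall _ _))
    exact h2.mono_set (prod_mono Ioc_subset_Icc_self ball_subset_closedBall)
  -- After the swap, rotation invariance of the ball makes the inner integral independent of `θ`.
  have hswap := integral_integral_swap hint
  have hl : ∀ θ : ℝ, ∫ v in ball (0 : Fin n → ℂ) δ, g (z + circleMap 0 1 θ • v) =
      ∫ y in ball z δ, g y := fun θ => by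
    rw [← hshift]
    exact setIntegral_ball_smul (by simp) (fun v => g (z + v)) δ
  simp only [hl] at hswap
  rw [setIntegral_congr_fun measurableSet_ball hcircle] at hswap
  simp only [integral_const, measureReal_restrict_apply_univ, Real.volume_real_Ioc, sub_zero,
    Complex.real_smul, max_eq_left Real.two_pi_pos.le] at hswap
  rw [hvol]
  have hpi : (Real.pi : ℂ) ≠ 0 := by exact_mod_cast Real.pi_ne_zero
  push_cast at hswap
  have : (2 * Real.pi : ℂ) ≠ 0 := by simp [hpi]
  refine mul_left_cancel₀ this (hswap.trans ?_)
  rw [measureReal_def]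
  ring

/-- Point evaluations are locally uniformly bounded on the Bergman space. -/
theorem exists_norm_apply_le (hD : IsOpen D) {w : Fin n → ℂ} (hw : w ∈ D) :
    ∃ δ > 0, ball w δ ⊆ D ∧ ∃ C, 0 ≤ C ∧ ∀ g, MemBergman D g → ∀ z ∈ ball w δ,
      ‖g z‖ ≤ C * (eLpNorm g 2 (volume.restrict D)).toReal := by
  obtain ⟨r, hr, hrD⟩ := Metric.isOpen_iff.1 hD w hw
  set δ := r / 2 with hδ
  have hδ0 : 0 < δ := by positivity
  set V := volume (ball (0 : Fin n → ℂ) δ) with hV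
  have hV0 : 0 < V.toReal := ENNReal.toReal_pos (measure_ball_pos _ _ hδ0).ne' measure_ball_lt_top.ne
  -- The mean value property contributes `1 / V` and the Cauchy–Schwarz inequality `V ^ (1 / 2)`.
  refine ⟨δ, hδ0, (ball_subset_ball (by linarith)).trans hrD,
    (V ^ (1 / 2 : ℝ)).toReal / V.toReal, by positivity, fun g hg z hz => ?_⟩
  have hzD : closedBall z δ ⊆ D := by
    refine (closedBall_subset_ball' (?_ : δ + dist z w < r)).trans hrD
    rw [mem_ball] at hz
    linarith
  have hvol : volume (ball z δ) = V := Measure.addHaar_ball_center _ _ _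
  have hbD : ball z δ ⊆ D := ball_subset_closedBall.trans hzD
  have hle : volume.restrict (ball z δ) ≤ volume.restrict D := Measure.restrict_mono_set _ hbD
  have hgm : AEStronglyMeasurable g (volume.restrict (ball z δ)) :=
    hg.2.aestronglyMeasurable.mono_measure hle
  have h1 := setIntegral_ball_eq hD hg.1 hzD
  have h2 : ‖∫ y in ball z δ, g y‖ ≤ (eLpNorm g 1 (volume.restrict (ball z δ))).toReal := by
    rw [eLpNorm_one_eq_lintegral_enorm, ← integral_norm_eq_lintegral_enorm hgm]
    exact norm_integral_le_integral_norm _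
  have h3 : eLpNorm g 1 (volume.restrict (ball z δ)) ≤
      eLpNorm g 2 (volume.restrict D) * V ^ (1 / 2 : ℝ) := by
    refine (eLpNorm_le_eLpNorm_mul_rpow_measure_univ (p := 1) (q := 2) (by norm_num) hgm).trans ?_
    have he : 1 / (1 : ENNReal).toReal - 1 / (2 : ENNReal).toReal = (1 / 2 : ℝ) := by norm_num
    rw [he, Measure.restrict_apply_univ, hvol]
    gcongr
  have h4 : (eLpNorm g 1 (volume.restrict (ball z δ))).toReal ≤
      (eLpNorm g 2 (volume.restrict D)).toReal * (V ^ (1 / 2 : ℝ)).toReal := by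
    rw [← ENNReal.toReal_mul]
    refine ENNReal.toReal_mono (ENNReal.mul_ne_top hg.2.eLpNorm_ne_top ?_) h3
    exact ENNReal.rpow_ne_top_of_nonneg (by norm_num) measure_ball_lt_top.ne
  rw [h1, hvol, norm_mul, Complex.norm_real, Real.norm_of_nonneg hV0.le] at h2
  rw [div_mul_eq_mul_div, le_div_iff₀ hV0]
  linarith

theorem MemBergman.add {g h : (Fin n → ℂ) → ℂ} (hg : MemBergman D g) (hh : MemBergman D h) :
    MemBergman D (g + h) := ⟨hg.1.add hh.1, hg.2.add hh.2⟩

theorem MemBergman.const_smul {g : (Fin n → ℂ) → ℂ} (c : ℂ) (hg : MemBergman D g) :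
    MemBergman D (c • g) := ⟨hg.1.const_smul c, hg.2.const_smul c⟩

theorem MemBergman.sub {g h : (Fin n → ℂ) → ℂ} (hg : MemBergman D g) (hh : MemBergman D h) :
    MemBergman D (g - h) := ⟨hg.1.sub hh.1, hg.2.sub hh.2⟩

theorem memBergman_sum {ι : Type*} (s : Finset ι) {g : ι → (Fin n → ℂ) → ℂ}
    (hg : ∀ i, MemBergman D (g i)) : MemBergman D (fun z => ∑ i ∈ s, g i z) :=
  ⟨DifferentiableOn.fun_sum fun i _ => (hg i).1, memLp_finsetSum s fun i _ => (hg i).2⟩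

theorem MemBergman.integrable_mul_conj {g h : (Fin n → ℂ) → ℂ} (hg : MemBergman D g)
    (hh : MemBergman D h) : Integrable (fun z => g z * conj (h z)) (volume.restrict D) := by
  exact hg.2.integrable_mul (q := 2) (p := 2) hh.2.star

/-- Entire functions lie in the Bergman space of a bounded domain. -/
theorem memBergman_of_differentiable (hDb : Bornology.IsBounded D) {g : (Fin n → ℂ) → ℂ}
    (hg : Differentiable ℂ g) : MemBergman D g := by
  refine ⟨hg.differentiableOn, ?_⟩
  have hc : IsCompact (closure D) := hDb.isCompact_closure
  obtain ⟨C, hC⟩ := hc.exists_bound_of_continuousOn hg.continuous.continuousOn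
  have : IsFiniteMeasure (volume.restrict (closure D)) :=
    ⟨by rw [Measure.restrict_apply_univ]; exact hc.measure_lt_top⟩
  refine (MemLp.of_bound (μ := volume.restrict (closure D))
    hg.continuous.aestronglyMeasurable C ?_).mono_measure
    (Measure.restrict_mono_set _ subset_closure)
  exact ae_restrict_of_forall_mem isClosed_closure.measurableSet hC

/-- The Bergman space as a subspace of `L²`. -/
def bergmanSpace (D : Set (Fin n → ℂ)) : Submodule ℂ (Lp ℂ 2 (volume.restrict D)) where
  carrier := {u | ∃ g, DifferentiableOn ℂ g D ∧ u =ᵐ[volume.restrict D] g}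
  zero_mem' := ⟨0, differentiableOn_const 0, Lp.coeFn_zero _ _ _⟩
  add_mem' := by
    rintro u v ⟨g, hg, hug⟩ ⟨h, hh, hvh⟩
    exact ⟨g + h, hg.add hh, (Lp.coeFn_add u v).trans (hug.add hvh)⟩
  smul_mem' := by
    rintro c u ⟨g, hg, hug⟩
    exact ⟨c • g, hg.const_smul c, (Lp.coeFn_smul c u).trans (hug.const_smul c)⟩

/-- Since the `L²` norm controls values locally uniformly, `L²` convergence forces locally uniform
convergence of the holomorphic representatives, and the limit is holomorphic. -/
theorem isClosed_bergmanSpace (hD : IsOpen D) :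
    IsClosed (bergmanSpace D : Set (Lp ℂ 2 (volume.restrict D))) := by
  refine IsSeqClosed.isClosed fun u v hu huv => ?_
  choose g hg hug using hu
  have hgm : ∀ k, MemBergman D (g k) := fun k => ⟨hg k, (memLp_congr_ae (hug k)).1 (Lp.memLp (u k))⟩
  have hnorm : ∀ k l, (eLpNorm (g k - g l) 2 (volume.restrict D)).toReal = dist (u k) (u l) := by
    intro k l
    rw [Lp.dist_def]
    exact congrArg _ (eLpNorm_congr_ae ((hug k).sub (hug l)).symm)
  have hcau : ∀ w ∈ D, ∃ δ > 0, ball w δ ⊆ D ∧ UniformCauchySeqOn g atTop (ball w δ) := by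
    intro w hw
    obtain ⟨δ, hδ, hδD, C, hC0, hC⟩ := exists_norm_apply_le hD hw
    refine ⟨δ, hδ, hδD, ?_⟩
    rw [Metric.uniformCauchySeqOn_iff]
    intro ε hε
    obtain ⟨N, hN⟩ := Metric.cauchySeq_iff.1 huv.cauchySeq (ε / (C + 1)) (by positivity)
    refine ⟨N, fun k hk l hl z hz => ?_⟩
    have h1 := hC _ ((hgm k).sub (hgm l)) z hz
    rw [hnorm] at h1
    rw [dist_eq_norm]
    refine h1.trans_lt ?_
    have h2 := hN k hk l hl
    rw [lt_div_iff₀ (by positivity)] at h2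
    nlinarith [dist_nonneg (x := u k) (y := u l)]
  have hlim : ∀ w ∈ D, ∃ L, Tendsto (fun k => g k w) atTop (𝓝 L) := fun w hw => by
    obtain ⟨δ, hδ, hδD, h⟩ := hcau w hw
    exact cauchySeq_tendsto_of_complete (h.cauchySeq (mem_ball_self hδ))
  choose! G hG using hlim
  refine ⟨G, fun w hw => ?_, ?_⟩
  · obtain ⟨δ, hδ, hδD, h⟩ := hcau w hw
    exact (differentiableAt_of_tendstoUniformlyOn_ball hδ (fun k => (hg k).mono hδD)
      (h.tendstoUniformlyOn_of_tendsto fun z hz => hG z (hδD hz))).differentiableWithinAt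
  -- A subsequence converging almost everywhere identifies the `L²` limit with the pointwise limit
  -- `G`.
  · obtain ⟨ns, hns, hae⟩ := (tendstoInMeasure_of_tendsto_Lp huv).exists_seq_tendsto_ae
    filter_upwards [hae, ae_all_iff.2 hug, ae_restrict_mem hD.measurableSet] with x hx hx' hxD
    refine tendsto_nhds_unique hx ?_
    simp only [hx']
    exact (hG x hxD).comp hns.tendsto_atTop

/-- Bounded linear functionals on the Bergman space are represented by its elements. -/
theorem exists_representer (hD : IsOpen D) (l : ((Fin n → ℂ) → ℂ) → ℂ)
    (hadd : ∀ g h, MemBergman D g → MemBergman D h → l (g + h) = l g + l h)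
    (hsmul : ∀ (c : ℂ) g, MemBergman D g → l (c • g) = c * l g) (C : ℝ)
    (hC : ∀ g, MemBergman D g → ‖l g‖ ≤ C * (eLpNorm g 2 (volume.restrict D)).toReal) :
    ∃ k, MemBergman D k ∧ ∀ g, MemBergman D g → l g = ∫ z in D, g z * conj (k z) := by
  -- The functional is given on functions; the norm bound makes it descend to almost-everywhere
  -- classes, where Riesz representation applies.
  have hcongr : ∀ g h, MemBergman D g → MemBergman D h → g =ᵐ[volume.restrict D] h →
      l g = l h := by
    intro g h hg hh hgh
    have h1 := hC _ (hg.add (hh.const_smul (-1)))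
    have h2 : eLpNorm (g + (-1 : ℂ) • h) 2 (volume.restrict D) = 0 := by
      rw [eLpNorm_congr_ae (g := 0), eLpNorm_zero]
      filter_upwards [hgh] with x hx
      simp [hx]
    rw [h2, hadd _ _ hg (hh.const_smul _), hsmul _ _ hh, ENNReal.toReal_zero, mul_zero,
      norm_le_zero_iff] at h1
    linear_combination h1
  have hrep : ∀ u : bergmanSpace D, ∃ g, MemBergman D g ∧
      (u : Lp ℂ 2 (volume.restrict D)) =ᵐ[volume.restrict D] g := by
    rintro ⟨u, g, hg, hug⟩
    exact ⟨g, ⟨hg, (memLp_congr_ae hug).1 (Lp.memLp u)⟩, hug⟩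
  choose rep hrepm hrepe using hrep
  let L₀ : bergmanSpace D →ₗ[ℂ] ℂ :=
    { toFun := fun u => l (rep u)
      map_add' := fun u v => by
        rw [← hadd _ _ (hrepm u) (hrepm v)]
        refine hcongr _ _ (hrepm _) ((hrepm u).add (hrepm v)) ?_
        exact (hrepe (u + v)).symm.trans ((Lp.coeFn_add _ _).trans ((hrepe u).add (hrepe v)))
      map_smul' := fun c u => by
        rw [RingHom.id_apply, smul_eq_mul, ← hsmul _ _ (hrepm u)]
        refine hcongr _ _ (hrepm _) ((hrepm u).const_smul c) ?_
        exact (hrepe (c • u)).symm.trans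
          ((Lp.coeFn_smul _ _).trans ((hrepe u).const_smul c)) }
  let L : StrongDual ℂ (bergmanSpace D) := L₀.mkContinuous C fun u => by
    refine (hC _ (hrepm u)).trans_eq ?_
    rw [← eLpNorm_congr_ae (hrepe u)]
    rfl
  have : CompleteSpace (bergmanSpace D) := (isClosed_bergmanSpace hD).completeSpace_coe
  set k₀ := (InnerProductSpace.toDual ℂ (bergmanSpace D)).symm L with hk₀
  refine ⟨rep k₀, hrepm k₀, fun g hg => ?_⟩
  set u : bergmanSpace D := ⟨hg.2.toLp g, g, hg.1, hg.2.coeFn_toLp⟩ with hu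
  have hug : (u : Lp ℂ 2 (volume.restrict D)) =ᵐ[volume.restrict D] g := hg.2.coeFn_toLp
  have h1 : l g = L u := hcongr _ _ hg (hrepm u) (hug.symm.trans (hrepe u))
  have h2 : inner ℂ k₀ u = L u := InnerProductSpace.toDual_symm_apply
  rw [h1, ← h2, Submodule.coe_inner, L2.inner_def]
  refine integral_congr_ae ?_
  filter_upwards [hug, hrepe k₀] with x hx hx'
  rw [hx, hx', RCLike.inner_apply]

theorem exists_isBergmanKernel (hD : IsOpen D) : ∃ K, IsBergmanKernel D K := by
  have h : ∀ w ∈ D, ∃ k, MemBergman D k ∧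
      ∀ g, MemBergman D g → g w = ∫ z in D, g z * conj (k z) := by
    intro w hw
    obtain ⟨δ, hδ, hδD, C, hC0, hC⟩ := exists_norm_apply_le hD hw
    exact exists_representer hD (fun g => g w) (fun _ _ _ _ => rfl) (fun _ _ _ => rfl) C
      fun g hg => hC g hg w (mem_ball_self hδ)
  choose! k hk hk' using h
  exact ⟨fun z w => k w z, fun w hw => hk w hw, fun g hg w hw => hk' w hw g hg⟩

/-- The derivatives at a point are locally uniformly bounded on the Bergman space. -/
theorem exists_norm_fderiv_le (hD : IsOpen D) {w : Fin n → ℂ} (hw : w ∈ D) :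
    ∃ δ > 0, ball w δ ⊆ D ∧ ∃ C, 0 ≤ C ∧ ∀ g, MemBergman D g → ∀ z ∈ ball w δ,
      ‖fderiv ℂ g z‖ ≤ C * (eLpNorm g 2 (volume.restrict D)).toReal := by
  obtain ⟨δ, hδ, hδD, C, hC0, hC⟩ := exists_norm_apply_le hD hw
  refine ⟨δ / 2, by positivity, (ball_subset_ball (by linarith)).trans hδD, 4 * C / δ,
    by positivity, fun g hg z hz => ?_⟩
  have hz' : ball z (δ / 2) ⊆ ball w δ := by
    refine ball_subset_ball' ?_
    rw [mem_ball] at hz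
    linarith
  refine (norm_fderiv_le_of_bounded_on_ball (r := δ / 2) (by positivity)
    (hg.1.mono (hz'.trans hδD)) fun y hy => hC g hg y (hz' hy)).trans_eq ?_
  field_simp
  ring

/-- Directional derivatives at a point are represented by elements of the Bergman space. -/
theorem exists_fderiv_representer (hD : IsOpen D) {w : Fin n → ℂ} (hw : w ∈ D) (v : Fin n → ℂ) :
    ∃ k, MemBergman D k ∧
      ∀ g, MemBergman D g → fderiv ℂ g w v = ∫ z in D, g z * conj (k z) := by
  obtain ⟨δ, hδ, hδD, C, hC0, hC⟩ := exists_norm_fderiv_le hD hw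
  have hd : ∀ g, MemBergman D g → DifferentiableAt ℂ g w := fun g hg =>
    hg.1.differentiableAt (hD.mem_nhds hw)
  refine exists_representer hD (fun g => fderiv ℂ g w v) (fun g h hg hh => ?_)
    (fun c g hg => ?_) (C * ‖v‖) fun g hg => ?_
  · rw [fderiv_add (hd g hg) (hd h hh)]; rfl
  · rw [fderiv_const_smul (hd g hg)]; rfl
  · refine (ContinuousLinearMap.le_opNorm _ _).trans ?_
    have := hC g hg w (mem_ball_self hδ)
    nlinarith [norm_nonneg v, mul_le_mul_of_nonneg_right this (norm_nonneg v)]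

end BergmanSpace

/-! ### The transformation law of the Bergman kernel -/

section Transformation

variable {n : ℕ} {D D₁ D₂ : Set (Fin n → ℂ)} {f : (Fin n → ℂ) → (Fin n → ℂ)}

/-- The complex Jacobian determinant. -/
def jac (f : (Fin n → ℂ) → (Fin n → ℂ)) (z : Fin n → ℂ) : ℂ := (fderiv ℂ f z).det

theorem fderiv_apply_coord {z : Fin n → ℂ} (hf : DifferentiableAt ℂ f z) (v : Fin n → ℂ)
    (i : Fin n) : fderiv ℂ f z v i = fderiv ℂ (fun w => f w i) z v := by
  have h := hasFDerivAt_pi'.1 hf.hasFDerivAt i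
  rw [h.fderiv]
  rfl

theorem differentiableOn_jac (hD : IsOpen D) (hf : DifferentiableOn ℂ f D) :
    DifferentiableOn ℂ (jac f) D := by
  have h1 : ∀ z ∈ D, jac f z = ∑ σ : Equiv.Perm (Fin n), ((Equiv.Perm.sign σ : ℤ) : ℂ) *
      ∏ j, fderiv ℂ (fun w => f w (σ j)) z (Pi.single j 1) := by
    intro z hz
    rw [jac, ContinuousLinearMap.det, ← LinearMap.det_toMatrix', Matrix.det_apply']
    refine Finset.sum_congr rfl fun σ _ => ?_
    congr 1
    refine Finset.prod_congr rfl fun j _ => ?_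
    rw [← fderiv_apply_coord (hf.differentiableAt (hD.mem_nhds hz)), LinearMap.toMatrix'_apply]
    simp
  refine DifferentiableOn.congr ?_ h1
  refine DifferentiableOn.fun_sum fun σ _ => DifferentiableOn.const_mul ?_ _
  exact fun z hz => (HasFDerivWithinAt.finsetProd fun j _ =>
    (differentiableOn_fderiv_apply hD (differentiableOn_pi.1 hf (σ j)) (Pi.single j 1)
      z hz).hasFDerivWithinAt).differentiableWithinAt

theorem abs_det_restrictScalars (A : (Fin n → ℂ) →L[ℂ] (Fin n → ℂ)) :
    |(A.restrictScalars ℝ).det| = ‖A.det‖ ^ 2 := by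
  have h : (A.restrictScalars ℝ).det = Complex.normSq A.det := by
    have := LinearMap.det_restrictScalars (R := ℝ) (f := (A : (Fin n → ℂ) →ₗ[ℂ] (Fin n → ℂ)))
    rw [Algebra.norm_complex_apply] at this
    exact this
  rw [h, Complex.normSq_eq_norm_sq, abs_of_nonneg (by positivity)]

theorem IsBiholomorphism.injOn (hf : IsBiholomorphism f D₁ D₂) : InjOn f D₁ := by
  obtain ⟨-, -, g, -, -, hgf, -⟩ := hf
  exact hgf.injOn

theorem IsBiholomorphism.image_eq (hf : IsBiholomorphism f D₁ D₂) : f '' D₁ = D₂ := by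
  obtain ⟨-, hm, g, -, hm', -, hfg⟩ := hf
  exact (hm.image_subset).antisymm fun w hw => ⟨g w, hm' hw, hfg hw⟩

theorem IsBiholomorphism.hasFDerivWithinAt (hf : IsBiholomorphism f D₁ D₂) (hD₁ : IsOpen D₁) :
    ∀ z ∈ D₁, HasFDerivWithinAt f ((fderiv ℂ f z).restrictScalars ℝ) D₁ z := fun _ hz =>
  ((hf.1.differentiableAt (hD₁.mem_nhds hz)).hasFDerivAt.restrictScalars ℝ).hasFDerivWithinAt

/-- The change of variables formula for biholomorphisms. -/
theorem IsBiholomorphism.integral_eq (hf : IsBiholomorphism f D₁ D₂) (hD₁ : IsOpen D₁)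
    (φ : (Fin n → ℂ) → ℂ) :
    ∫ z in D₂, φ z = ∫ z in D₁, jac f z * conj (jac f z) * φ (f z) := by
  rw [← hf.image_eq, integral_image_eq_integral_abs_det_fderiv_smul volume hD₁.measurableSet
    (hf.hasFDerivWithinAt hD₁) hf.injOn]
  simp only [abs_det_restrictScalars, Complex.mul_conj, Complex.normSq_eq_norm_sq,
    Complex.real_smul]
  rfl

/-- The pullback of an element of the Bergman space under a biholomorphism. -/
theorem MemBergman.pullback (hf : IsBiholomorphism f D₁ D₂) (hD₁ : IsOpen D₁)
    {g : (Fin n → ℂ) → ℂ} (hg : MemBergman D₂ g) :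
    MemBergman D₁ (fun z => jac f z * g (f z)) := by
  have hd : DifferentiableOn ℂ (fun z => jac f z * g (f z)) D₁ :=
    (differentiableOn_jac hD₁ hf.1).mul (hg.1.comp hf.1 hf.2.1)
  refine ⟨hd, (memLp_two_iff_integrable_sq_norm
    (hd.continuousOn.aestronglyMeasurable hD₁.measurableSet)).2 ?_⟩
  have h := (memLp_two_iff_integrable_sq_norm hg.2.aestronglyMeasurable).1 hg.2
  rw [← hf.image_eq] at h
  have h2 := (integrableOn_image_iff_integrableOn_abs_det_fderiv_smul volume hD₁.measurableSet
    (hf.hasFDerivWithinAt hD₁) hf.injOn _).1 h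
  refine Integrable.congr h2 (Eventually.of_forall fun z => ?_)
  simp only [abs_det_restrictScalars, norm_mul, mul_pow, smul_eq_mul]
  rfl

theorem isBergmanKernel (hD : IsOpen D) : IsBergmanKernel D (bergmanKernel D) :=
  isBergmanKernel_bergmanKernel (exists_isBergmanKernel hD)

theorem IsBiholomorphism.exists_inverse (hf : IsBiholomorphism f D₁ D₂) :
    ∃ g, IsBiholomorphism g D₂ D₁ ∧ LeftInvOn g f D₁ ∧ RightInvOn g f D₂ := by
  obtain ⟨hd, hm, g, hgd, hgm, hgf, hfg⟩ := hf
  exact ⟨g, ⟨hgd, hgm, f, hd, hm, hfg, hgf⟩, hgf, hfg⟩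

theorem jac_mul_jac {g : (Fin n → ℂ) → (Fin n → ℂ)} {z : Fin n → ℂ}
    (hg : DifferentiableAt ℂ g (f z)) (hf : DifferentiableAt ℂ f z)
    (h : ∀ᶠ w in 𝓝 z, g (f w) = w) : jac g (f z) * jac f z = 1 := by
  have h1 : HasFDerivAt (fun w => g (f w)) ((fderiv ℂ g (f z)).comp (fderiv ℂ f z)) z :=
    hg.hasFDerivAt.comp z hf.hasFDerivAt
  have h2 : HasFDerivAt (fun w => g (f w)) (ContinuousLinearMap.id ℂ (Fin n → ℂ)) z :=
    (hasFDerivAt_id z).congr_of_eventuallyEq h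
  have h3 := congrArg ContinuousLinearMap.det (h1.unique h2)
  have h4 : (((fderiv ℂ g (f z)).comp (fderiv ℂ f z)).det) = jac g (f z) * jac f z :=
    LinearMap.det_comp _ _
  rw [← h4, h3]
  exact LinearMap.det_id

/-- The transformation law of the Bergman kernel. -/
theorem IsBiholomorphism.bergmanKernel_eq (hf : IsBiholomorphism f D₁ D₂) (hD₁ : IsOpen D₁)
    (hD₂ : IsOpen D₂) {z w : Fin n → ℂ} (hz : z ∈ D₁) (hw : w ∈ D₁) :
    bergmanKernel D₁ z w =
      jac f z * bergmanKernel D₂ (f z) (f w) * conj (jac f w) := by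
  refine (isBergmanKernel hD₁).unique (K' := fun z w =>
    jac f z * bergmanKernel D₂ (f z) (f w) * conj (jac f w)) ⟨fun w hw => ?_, ?_⟩ hz hw
  · have := (((isBergmanKernel hD₂).mem (f w) (hf.2.1 hw)).pullback hf hD₁).const_smul
      (conj (jac f w))
    convert this using 1
    ext z
    simp only [Pi.smul_apply, smul_eq_mul]
    ring
  · intro u hu w hw
    obtain ⟨g, hg, hgf, hfg⟩ := hf.exists_inverse
    have hj : ∀ z ∈ D₁, jac g (f z) * jac f z = 1 := fun z hz =>
      jac_mul_jac (hg.1.differentiableAt (hD₂.mem_nhds (hf.2.1 hz)))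
        (hf.1.differentiableAt (hD₁.mem_nhds hz))
        (eventually_of_mem (hD₁.mem_nhds hz) fun y hy => hgf hy)
    -- Reproduce on `D₂` the pullback of `u` under the inverse map, then change variables back to
    -- `D₁`.
    have h1 := (isBergmanKernel hD₂).reproducing _ (hu.pullback hg hD₂) (f w) (hf.2.1 hw)
    rw [hf.integral_eq hD₁] at h1
    simp only [hgf hw] at h1
    have h2 : u w = jac f w * (jac g (f w) * u w) := by
      rw [← mul_assoc, mul_comm (jac f w), hj w hw, one_mul]
    rw [h2, h1, ← integral_const_mul]
    refine setIntegral_congr_fun hD₁.measurableSet fun z hz => ?_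
    simp only [hgf hz, map_mul, Complex.conj_conj]
    linear_combination (jac f w * conj (jac f z) * u z *
      conj (bergmanKernel D₂ (f z) (f w))) * hj z hz

/-! ### The Bergman kernel of a bounded domain on the diagonal -/

theorem bergmanKernel_conj (hD : IsOpen D) {z w : Fin n → ℂ} (hz : z ∈ D) (hw : w ∈ D) :
    conj (bergmanKernel D z w) = bergmanKernel D w z :=
  ((isBergmanKernel hD).eq_conj (isBergmanKernel hD) hw hz).symm

theorem MemBergman.integral_self {g : (Fin n → ℂ) → ℂ} (hg : MemBergman D g) :
    ∫ z in D, g z * conj (g z) = ((eLpNorm g 2 (volume.restrict D)).toReal ^ 2 : ℝ) := by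
  have h1 : ∀ z, g z * conj (g z) = ((‖g z‖ ^ 2 : ℝ) : ℂ) := fun z => by
    rw [Complex.mul_conj, Complex.normSq_eq_norm_sq]
  simp only [h1]
  rw [integral_complex_ofReal]
  congr 1
  have h2 := hg.2.eLpNorm_eq_integral_rpow_norm (by norm_num) (by norm_num)
  rw [h2, ENNReal.toReal_ofReal (by positivity), ← Real.rpow_natCast, ← Real.rpow_mul (by positivity)]
  norm_num

theorem MemBergman.ae_eq_zero {g : (Fin n → ℂ) → ℂ} (hg : MemBergman D g)
    (h : ∫ z in D, g z * conj (g z) = 0) : g =ᵐ[volume.restrict D] 0 := by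
  rw [hg.integral_self, Complex.ofReal_eq_zero, sq_eq_zero_iff, ENNReal.toReal_eq_zero_iff,
    or_iff_left hg.2.eLpNorm_ne_top] at h
  exact (eLpNorm_eq_zero_iff hg.2.aestronglyMeasurable (by norm_num)).1 h

theorem bergmanKernel_self (hD : IsOpen D) {w : Fin n → ℂ} (hw : w ∈ D) :
    bergmanKernel D w w =
      ((eLpNorm (fun z => bergmanKernel D z w) 2 (volume.restrict D)).toReal ^ 2 : ℝ) := by
  rw [← ((isBergmanKernel hD).mem w hw).integral_self]
  exact (isBergmanKernel hD).reproducing _ ((isBergmanKernel hD).mem w hw) w hw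

/-- Otherwise `K(·, w)` has norm zero and every element of the Bergman space vanishes at `w`,
including the constant `1`, which belongs to it because `D` is bounded. -/
theorem bergmanKernel_self_ne_zero (hD : IsOpen D) (hDb : Bornology.IsBounded D) {w : Fin n → ℂ}
    (hw : w ∈ D) : bergmanKernel D w w ≠ 0 := by
  intro h
  have hK := isBergmanKernel hD
  have h1 := hK.reproducing _ (hK.mem w hw) w hw
  rw [h] at h1
  have h2 := (hK.mem w hw).ae_eq_zero h1.symm
  have h3 := hK.reproducing _ (memBergman_of_differentiable hDb (differentiable_const (1 : ℂ))) w hw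
  rw [integral_congr_ae (g := fun _ => 0), integral_zero] at h3
  · exact one_ne_zero h3
  · filter_upwards [h2] with z hz
    rw [hz]; simp

theorem exists_bergmanKernel_self_eq (hD : IsOpen D) (hDb : Bornology.IsBounded D)
    {w : Fin n → ℂ} (hw : w ∈ D) : ∃ c : ℝ, 0 < c ∧ bergmanKernel D w w = c := by
  refine ⟨_, ?_, bergmanKernel_self hD hw⟩
  have h := bergmanKernel_self_ne_zero hD hDb hw
  rw [bergmanKernel_self hD hw, Complex.ofReal_ne_zero] at h
  exact lt_of_le_of_ne (by positivity) h.symm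

end Transformation

/-! ### The Bergman kernel of a quasi-Reinhardt domain -/

section QuasiReinhardtKernel

variable {n r : ℕ} {m : Fin n → Fin r → ℤ} {D : Set (Fin n → ℂ)}

theorem IsQuasiReinhardt.isBiholomorphism_torusAction (hD : IsQuasiReinhardt m D)
    (lam : Fin r → Circle) : IsBiholomorphism (torusAction m lam) D D := by
  have hd : ∀ lam, Differentiable ℂ (torusAction m lam) := fun lam => by
    have := (torusCLM m lam).differentiable
    rwa [funext (torusCLM_apply (m := m) lam)] at this
  refine ⟨(hd lam).differentiableOn, hD.invariant lam, torusAction m lam⁻¹,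
    (hd _).differentiableOn, hD.invariant lam⁻¹, fun z _ => torusAction_inv lam z, fun z _ => ?_⟩
  have := torusAction_inv (m := m) lam⁻¹ z
  rwa [inv_inv] at this

theorem fderiv_torusAction (lam : Fin r → Circle) (z : Fin n → ℂ) :
    fderiv ℂ (torusAction m lam) z = torusCLM m lam := by
  rw [← funext (torusCLM_apply (m := m) lam)]
  exact (torusCLM m lam).fderiv

theorem torusAction_zero (lam : Fin r → Circle) : torusAction m lam 0 = 0 := by
  rw [← torusCLM_apply, map_zero]

/-- The Jacobian determinant of the action is constant, and the transformation law at `(0, 0)`,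
where the kernel is nonzero, forces its modulus to be one. -/
theorem IsQuasiReinhardt.bergmanKernel_torusAction (hD : IsQuasiReinhardt m D)
    (lam : Fin r → Circle) {z w : Fin n → ℂ} (hz : z ∈ D) (hw : w ∈ D) :
    bergmanKernel D (torusAction m lam z) (torusAction m lam w) = bergmanKernel D z w := by
  have h := fun z hz w hw => (hD.isBiholomorphism_torusAction lam).bergmanKernel_eq hD.isOpen
    hD.isOpen (z := z) (w := w) hz hw
  have hj : ∀ z, jac (torusAction m lam) z = (torusCLM m lam).det := fun z => by
    rw [jac, fderiv_torusAction]
  simp only [hj] at h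
  have h0 := h 0 hD.zero_mem 0 hD.zero_mem
  rw [torusAction_zero] at h0
  have hne := bergmanKernel_self_ne_zero hD.isOpen hD.isBounded hD.zero_mem
  have h1 : (torusCLM m lam).det * conj (torusCLM m lam).det = 1 :=
    mul_right_cancel₀ hne (by linear_combination -h0)
  rw [h z hz w hw]
  linear_combination (-bergmanKernel D (torusAction m lam z) (torusAction m lam w)) * h1

theorem IsQuasiReinhardt.bergmanKernel_zero_right (hD : IsQuasiReinhardt m D)
    {z : Fin n → ℂ} (hz : z ∈ D) : bergmanKernel D z 0 = bergmanKernel D 0 0 := by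
  refine IsSemiInvariantOn.eq_const (g := fun z => bergmanKernel D z 0) hD.onlyConstantInvariants
    hD.isOpen hD.isConnected.isPreconnected hD.zero_mem
    ((isBergmanKernel hD.isOpen).mem 0 hD.zero_mem).1 (fun lam z hz => ?_) hz
  have := hD.bergmanKernel_torusAction lam hz hD.zero_mem
  rw [torusAction_zero] at this
  simp [this, weightChar_zero]

theorem IsQuasiReinhardt.bergmanKernel_zero_left (hD : IsQuasiReinhardt m D)
    {z : Fin n → ℂ} (hz : z ∈ D) : bergmanKernel D 0 z = bergmanKernel D 0 0 := by
  rw [← bergmanKernel_conj hD.isOpen hz hD.zero_mem, hD.bergmanKernel_zero_right hz,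
    bergmanKernel_conj hD.isOpen hD.zero_mem hD.zero_mem]

/-- A biholomorphism of quasi-Reinhardt domains fixing the origin preserves the Bergman kernels up
to a constant factor. -/
theorem IsQuasiReinhardt.exists_bergmanKernel_eq {r' : ℕ} {m' : Fin n → Fin r' → ℤ}
    {D' : Set (Fin n → ℂ)} (hD : IsQuasiReinhardt m D) (hD' : IsQuasiReinhardt m' D')
    {f : (Fin n → ℂ) → (Fin n → ℂ)} (hf : IsBiholomorphism f D D') (hf0 : f 0 = 0) :
    ∃ s : ℝ, ∀ z ∈ D, ∀ w ∈ D,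
      bergmanKernel D z w = s * bergmanKernel D' (f z) (f w) := by
  have h := fun z hz w hw => hf.bergmanKernel_eq hD.isOpen hD'.isOpen (z := z) (w := w) hz hw
  have hne := bergmanKernel_self_ne_zero hD.isOpen hD.isBounded hD.zero_mem
  have h00 := h 0 hD.zero_mem 0 hD.zero_mem
  -- In the transformation law with `w = 0` both kernels are constant in `z`, so the Jacobian must
  -- be too.
  have hj : ∀ z ∈ D, jac f z = jac f 0 := by
    intro z hz
    have h1 := h z hz 0 hD.zero_mem
    rw [hf0, hD.bergmanKernel_zero_right hz, hD'.bergmanKernel_zero_right (hf.2.1 hz)] at h1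
    rw [hf0] at h00
    rw [h00] at h1 hne
    exact (mul_right_cancel₀ (right_ne_zero_of_mul (left_ne_zero_of_mul hne))
      (mul_right_cancel₀ (right_ne_zero_of_mul hne) h1)).symm
  refine ⟨‖jac f 0‖ ^ 2, fun z hz w hw => ?_⟩
  have h1 : jac f 0 * conj (jac f 0) = ((‖jac f 0‖ ^ 2 : ℝ) : ℂ) := by
    rw [Complex.mul_conj, Complex.normSq_eq_norm_sq]
  rw [h z hz w hw, hj z hz, hj w hw, ← h1]
  ring

end QuasiReinhardtKernel

/-! ### Wirtinger derivatives -/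

section Wirtinger

variable {n : ℕ} {g : (Fin n → ℂ) → ℂ} {z : Fin n → ℂ}

theorem single_I (k : Fin n) : (Pi.single k Complex.I : Fin n → ℂ) =
    Complex.I • (Pi.single k 1 : Fin n → ℂ) := by
  rw [← Pi.single_smul, smul_eq_mul, mul_one]

theorem wirtinger_eq {L : (Fin n → ℂ) →L[ℂ] ℂ} (h : HasFDerivAt g L z) (k : Fin n) :
    wirtinger k g z = L (Pi.single k 1) := by
  rw [wirtinger, (h.restrictScalars ℝ).fderiv, single_I]
  simp only [ContinuousLinearMap.coe_restrictScalars', map_smul, smul_eq_mul]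
  linear_combination (-L (Pi.single k 1) / 2) * Complex.I_mul_I

/-- The conjugate of a complex linear form, as a real linear map. -/
def conjForm (L : (Fin n → ℂ) →L[ℂ] ℂ) : (Fin n → ℂ) →L[ℝ] ℂ :=
  Complex.conjCLE.toContinuousLinearMap.comp (L.restrictScalars ℝ)

theorem conjForm_apply (L : (Fin n → ℂ) →L[ℂ] ℂ) (v : Fin n → ℂ) : conjForm L v = conj (L v) :=
  rfl

theorem hasFDerivAt_conj {L : (Fin n → ℂ) →L[ℂ] ℂ} (h : HasFDerivAt g L z) :
    HasFDerivAt (fun w => conj (g w)) (conjForm L) z :=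
  Complex.conjCLE.toContinuousLinearMap.hasFDerivAt.comp z (h.restrictScalars ℝ)

theorem wirtingerBar_eq {L : (Fin n → ℂ) →L[ℂ] ℂ} {c : ℂ} (h : HasFDerivAt g (c • conjForm L) z)
    (k : Fin n) : wirtingerBar k g z = c * conj (L (Pi.single k 1)) := by
  rw [wirtingerBar, h.fderiv, single_I]
  simp only [smul_apply, conjForm_apply, map_smul, smul_eq_mul, map_mul,
    Complex.conj_I]
  linear_combination (-c * conj (L (Pi.single k 1)) / 2) * Complex.I_mul_I

end Wirtinger

/-! ### The representative coordinates at the origin -/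

section Coordinates

variable {n : ℕ} {D : Set (Fin n → ℂ)}

/-- The gradient of `K_D(z, w)` in `w̄` at `w = 0`. -/
def kernelGrad (D : Set (Fin n → ℂ)) (i : Fin n) (z : Fin n → ℂ) : ℂ :=
  conj (fderiv ℂ (fun w => bergmanKernel D w z) 0 (Pi.single i 1))

/-- The derivative of `kernelGrad` at the origin. -/
def kernelHess (D : Set (Fin n → ℂ)) : Matrix (Fin n) (Fin n) ℂ :=
  Matrix.of fun i k => fderiv ℂ (kernelGrad D i) 0 (Pi.single k 1)

theorem MemBergman.congr {g h : (Fin n → ℂ) → ℂ} (hD : IsOpen D) (hg : MemBergman D g)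
    (hgh : ∀ z ∈ D, h z = g z) : MemBergman D h :=
  ⟨hg.1.congr hgh, (memLp_congr_ae (by
    filter_upwards [ae_restrict_mem hD.measurableSet] with z hz
    exact hgh z hz)).2 hg.2⟩

/-- `kernelGrad` represents the partial derivatives at the origin. -/
theorem kernelGrad_spec (hD : IsOpen D) (h0 : 0 ∈ D) (i : Fin n) :
    MemBergman D (kernelGrad D i) ∧ ∀ g, MemBergman D g →
      fderiv ℂ g 0 (Pi.single i 1) = ∫ z in D, g z * conj (kernelGrad D i z) := by
  obtain ⟨k, hk, hk'⟩ := exists_fderiv_representer hD h0 (Pi.single i 1)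
  -- Apply the functional to `K(·, z)` and conjugate; the reproducing property turns the integral
  -- into `k z`.
  have h : ∀ z ∈ D, kernelGrad D i z = k z := by
    intro z hz
    rw [kernelGrad, hk' _ ((isBergmanKernel hD).mem z hz), ← integral_conj,
      (isBergmanKernel hD).reproducing k hk z hz]
    simp [mul_comm]
  refine ⟨hk.congr hD h, fun g hg => ?_⟩
  rw [hk' g hg]
  exact setIntegral_congr_fun hD.measurableSet fun z hz => by simp only [h z hz]

theorem kernelHess_apply (hD : IsOpen D) (h0 : 0 ∈ D) (i k : Fin n) :
    kernelHess D i k = ∫ z in D, kernelGrad D i z * conj (kernelGrad D k z) :=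
  (kernelGrad_spec hD h0 k).2 _ (kernelGrad_spec hD h0 i).1

theorem conj_kernelHess (hD : IsOpen D) (h0 : 0 ∈ D) (i k : Fin n) :
    conj (kernelHess D k i) = kernelHess D i k := by
  rw [kernelHess_apply hD h0, kernelHess_apply hD h0, ← integral_conj]
  simp [mul_comm]

/-- A null vector `v` of this Gram matrix yields a combination `H` of norm zero representing `g ↦ ∑
v_i ∂_i g(0)`. This functional then vanishes, and testing it on the coordinate function `z_k` gives
`v_k = 0`. -/
theorem isUnit_det_kernelHess (hD : IsOpen D) (hDb : Bornology.IsBounded D) (h0 : 0 ∈ D) :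
    IsUnit (kernelHess D).det := by
  rw [isUnit_iff_ne_zero]
  intro hdet
  obtain ⟨v, hv, hAv⟩ := Matrix.exists_mulVec_eq_zero_iff.2 hdet
  set H : (Fin n → ℂ) → ℂ := fun z => ∑ i, conj (v i) * kernelGrad D i z with hH
  have hHm : MemBergman D H := memBergman_sum _ fun i =>
    ((kernelGrad_spec hD h0 i).1).const_smul (conj (v i))
  have hrep : ∀ g, MemBergman D g →
      ∫ z in D, g z * conj (H z) = ∑ i, v i * fderiv ℂ g 0 (Pi.single i 1) := by
    intro g hg
    simp only [(kernelGrad_spec hD h0 _).2 g hg, ← integral_const_mul]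
    rw [← integral_finsetSum _ fun i _ =>
      (hg.integrable_mul_conj (kernelGrad_spec hD h0 i).1).const_mul (v i)]
    refine integral_congr_ae (Eventually.of_forall fun z => ?_)
    simp only [hH, map_sum, map_mul, Complex.conj_conj, Finset.mul_sum]
    exact Finset.sum_congr rfl fun i _ => by ring
  have hHH : ∫ z in D, H z * conj (H z) = 0 := by
    rw [hrep H hHm]
    have h1 : ∀ k, fderiv ℂ H 0 (Pi.single k 1) = ∑ i, conj (v i) * kernelHess D i k := by
      intro k
      have h2 : HasFDerivAt H (∑ i, conj (v i) • fderiv ℂ (kernelGrad D i) 0) 0 :=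
        HasFDerivAt.fun_sum fun i _ =>
          (((kernelGrad_spec hD h0 i).1.1.differentiableAt
            (hD.mem_nhds h0)).hasFDerivAt.const_mul (conj (v i)))
      rw [h2.fderiv]
      simp [kernelHess]
    simp only [h1, Finset.mul_sum]
    rw [Finset.sum_comm]
    refine Finset.sum_eq_zero fun i _ => ?_
    have h2 := congrFun hAv i
    simp only [Matrix.mulVec, dotProduct, Pi.zero_apply] at h2
    calc ∑ k, v k * (conj (v i) * kernelHess D i k)
        = conj (v i) * ∑ k, kernelHess D i k * v k := by
          rw [Finset.mul_sum]
          exact Finset.sum_congr rfl fun k _ => by ring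
      _ = 0 := by rw [h2, mul_zero]
  have hH0 := hHm.ae_eq_zero hHH
  apply hv
  ext k
  have h1 := hrep _ (memBergman_of_differentiable hDb (differentiable_apply (𝕜 := ℂ) k))
  rw [integral_congr_ae (g := fun _ => 0), integral_zero] at h1
  · have h2 : HasFDerivAt (fun z : Fin n → ℂ => z k)
        (ContinuousLinearMap.proj k : (Fin n → ℂ) →L[ℂ] ℂ) 0 :=
      (ContinuousLinearMap.proj k : (Fin n → ℂ) →L[ℂ] ℂ).hasFDerivAt
    rw [h2.fderiv] at h1
    simpa [Pi.single_apply] using h1.symm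
  · filter_upwards [hH0] with z hz
    rw [hz]; simp

/-- The representative coordinates at the origin of a quasi-Reinhardt domain, computed without the
logarithm. -/
def kernelCoord (D : Set (Fin n → ℂ)) (z : Fin n → ℂ) : Fin n → ℂ :=
  (kernelHess D)⁻¹.mulVec fun i => kernelGrad D i z

theorem kernelCoord_apply (z : Fin n → ℂ) (i : Fin n) :
    kernelCoord D z i = ∑ k, (kernelHess D)⁻¹ i k * kernelGrad D k z := rfl

theorem kernelHess_mulVec_kernelCoord (hD : IsOpen D) (hDb : Bornology.IsBounded D) (h0 : 0 ∈ D)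
    (z : Fin n → ℂ) : (kernelHess D).mulVec (kernelCoord D z) = fun i => kernelGrad D i z := by
  rw [kernelCoord, Matrix.mulVec_mulVec, Matrix.mul_nonsing_inv _ (isUnit_det_kernelHess hD hDb h0),
    Matrix.one_mulVec]

theorem differentiableOn_kernelCoord (hD : IsOpen D) (h0 : 0 ∈ D) :
    DifferentiableOn ℂ (kernelCoord D) D := by
  rw [differentiableOn_pi]
  intro i
  simp only [kernelCoord_apply]
  exact DifferentiableOn.fun_sum fun k _ => (kernelGrad_spec hD h0 k).1.1.const_mul _

theorem hasFDerivAt_kernelCoord (hD : IsOpen D) (hDb : Bornology.IsBounded D) (h0 : 0 ∈ D) :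
    HasFDerivAt (kernelCoord D) (ContinuousLinearMap.id ℂ (Fin n → ℂ)) 0 := by
  rw [hasFDerivAt_pi']
  intro i
  have h1 : HasFDerivAt (fun z => kernelCoord D z i)
      (∑ k, (kernelHess D)⁻¹ i k • fderiv ℂ (kernelGrad D k) 0) 0 := by
    simp only [kernelCoord_apply]
    exact HasFDerivAt.fun_sum fun k _ => ((kernelGrad_spec hD h0 k).1.1.differentiableAt
      (hD.mem_nhds h0)).hasFDerivAt.const_mul ((kernelHess D)⁻¹ i k)
  refine h1.congr_fderiv (ContinuousLinearMap.ext fun v => ?_)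
  have h2 : ∀ k, fderiv ℂ (kernelGrad D k) 0 v = (kernelHess D).mulVec v k := by
    intro k
    rw [clm_apply_eq_sum]
    exact Finset.sum_congr rfl fun p _ => mul_comm _ _
  have h3 : (kernelHess D)⁻¹.mulVec ((kernelHess D).mulVec v) = v := by
    rw [Matrix.mulVec_mulVec, Matrix.nonsing_inv_mul _ (isUnit_det_kernelHess hD hDb h0),
      Matrix.one_mulVec]
  simp only [sum_apply, smul_apply, h2, smul_eq_mul]
  exact congrFun h3 i

end Coordinates

/-! ### Removal of the logarithms; linearity of biholomorphisms in representative coordinates. -/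

section RepresentativeCoordinates

variable {n r : ℕ} {m : Fin n → Fin r → ℤ} {D : Set (Fin n → ℂ)}

theorem hasFDerivAt_bergmanKernel_right (hD : IsOpen D) (h0 : 0 ∈ D) {z : Fin n → ℂ} (hz : z ∈ D) :
    HasFDerivAt (fun w => bergmanKernel D z w)
      (conjForm (fderiv ℂ (fun w => bergmanKernel D w z) 0)) 0 := by
  have h1 := (((isBergmanKernel hD).mem z hz).1.differentiableAt (hD.mem_nhds h0)).hasFDerivAt
  refine (hasFDerivAt_conj h1).congr_of_eventuallyEq ?_
  filter_upwards [hD.mem_nhds h0] with w hw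
  exact (bergmanKernel_conj hD hw hz).symm

/-- With `u = K(·, w) - K(·, 0)`, constancy of `K(·, 0)` and `K(0, ·)` gives `K(w, w) - K(0, 0) =
u(w) - u(0) = ‖u‖²`. The gradient bound gives `‖u‖² ≤ C ‖u‖ ‖w‖`, so the difference is `O(‖w‖²)`.
Thus the denominator in the definition of the coordinates does not affect their gradient. -/
theorem IsQuasiReinhardt.hasFDerivAt_bergmanKernel_diag (hD : IsQuasiReinhardt m D) :
    HasFDerivAt (fun w => bergmanKernel D w w) (0 : (Fin n → ℂ) →L[ℝ] ℂ) 0 := by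
  obtain ⟨δ, hδ, hδD, C, hC0, hC⟩ := exists_norm_fderiv_le hD.isOpen hD.zero_mem
  have hK := isBergmanKernel hD.isOpen
  have h0 := hD.zero_mem
  have hbd : ∀ w ∈ ball (0 : Fin n → ℂ) δ,
      ‖bergmanKernel D w w - bergmanKernel D 0 0‖ ≤ C ^ 2 * ‖w‖ ^ 2 := by
    intro w hw
    have hwD := hδD hw
    set u : (Fin n → ℂ) → ℂ := (fun z => bergmanKernel D z w) - fun z => bergmanKernel D z 0
      with hu
    have hum : MemBergman D u := (hK.mem w hwD).sub (hK.mem 0 h0)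
    have h1 : u w - u 0 = bergmanKernel D w w - bergmanKernel D 0 0 := by
      simp only [hu, Pi.sub_apply, hD.bergmanKernel_zero_right hwD,
        hD.bergmanKernel_zero_left hwD]
      ring
    have h2 : u w - u 0 = ((eLpNorm u 2 (volume.restrict D)).toReal ^ 2 : ℝ) := by
      rw [← hum.integral_self, hK.reproducing u hum w hwD, hK.reproducing u hum 0 h0,
        ← integral_sub (hum.integrable_mul_conj (hK.mem w hwD))
          (hum.integrable_mul_conj (hK.mem 0 h0))]
      refine integral_congr_ae (Eventually.of_forall fun z => ?_)
      simp only [hu, Pi.sub_apply, map_sub]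
      ring
    have h3 : ‖u w - u 0‖ ≤ C * (eLpNorm u 2 (volume.restrict D)).toReal * ‖w - 0‖ :=
      (convex_ball (0 : Fin n → ℂ) δ).norm_image_sub_le_of_norm_fderiv_le (𝕜 := ℂ)
        (fun z hz => hum.1.differentiableAt (hD.isOpen.mem_nhds (hδD hz)))
        (fun z hz => hC u hum z hz) (mem_ball_self hδ) hw
    rw [← h1]
    rw [h2, Complex.norm_real, Real.norm_of_nonneg (by positivity), sub_zero] at h3
    rw [h2, Complex.norm_real, Real.norm_of_nonneg (by positivity), ← mul_pow]
    set N := (eLpNorm u 2 (volume.restrict D)).toReal with hN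
    have hN0 : 0 ≤ N := ENNReal.toReal_nonneg
    have h4 : N ≤ C * ‖w‖ := by
      rcases hN0.eq_or_lt with h | h
      · rw [← h]; positivity
      · exact le_of_mul_le_mul_right (by nlinarith) h
    gcongr
  have h1 : (fun w => bergmanKernel D w w - bergmanKernel D 0 0) =O[𝓝 0]
      fun w => ‖w - 0‖ ^ 2 := by
    refine Asymptotics.IsBigO.of_bound (C ^ 2) ?_
    filter_upwards [ball_mem_nhds _ hδ] with w hw
    simpa using hbd w hw
  have h2 := (Asymptotics.IsBigO.hasFDerivAt (𝕜 := ℝ) h1 (by norm_num)).add_const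
    (bergmanKernel D 0 0)
  simpa using h2

/-- The derivative of `log K(z, w)` in `z` at `z = 0` has denominator `K(0, w)`, which is constant
in `w`; only the mixed second derivative of `K` survives. -/
theorem IsQuasiReinhardt.bergmanTensor_eq (hD : IsQuasiReinhardt m D) :
    bergmanTensor D 0 0 = (bergmanKernel D 0 0)⁻¹ • kernelHess D := by
  obtain ⟨c, hc, hKc⟩ := exists_bergmanKernel_self_eq hD.isOpen hD.isBounded hD.zero_mem
  have hK := isBergmanKernel hD.isOpen
  ext i k
  rw [bergmanTensor, Matrix.of_apply, Matrix.smul_apply, smul_eq_mul,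
    ← conj_kernelHess hD.isOpen hD.zero_mem, kernelHess, Matrix.of_apply]
  refine wirtingerBar_eq ?_ i
  have h1 := (hasFDerivAt_conj (((kernelGrad_spec hD.isOpen hD.zero_mem k).1.1.differentiableAt
    (hD.isOpen.mem_nhds hD.zero_mem)).hasFDerivAt)).const_mul (bergmanKernel D 0 0)⁻¹
  refine h1.congr_of_eventuallyEq ?_
  filter_upwards [hD.isOpen.mem_nhds hD.zero_mem] with w hw
  have h2 := ((hK.mem w hw).1.differentiableAt
    (hD.isOpen.mem_nhds hD.zero_mem)).hasFDerivAt
  have h3 := h2.clog (by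
    rw [hD.bergmanKernel_zero_left hw, hKc]
    exact Complex.ofReal_mem_slitPlane.2 hc)
  rw [wirtinger_eq h3, kernelGrad, Complex.conj_conj, hD.bergmanKernel_zero_left hw]
  rfl

theorem IsQuasiReinhardt.bergmanCoord_eq (hD : IsQuasiReinhardt m D) {z : Fin n → ℂ}
    (hz : z ∈ D) : bergmanCoord D 0 z = kernelCoord D z := by
  have hne := bergmanKernel_self_ne_zero hD.isOpen hD.isBounded hD.zero_mem
  have hgrad : ∀ i, wirtingerBar i
      (fun w => Complex.log (bergmanKernel D z w / bergmanKernel D w w)) 0 =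
        (bergmanKernel D 0 0)⁻¹ * kernelGrad D i z := by
    intro i
    refine wirtingerBar_eq ?_ i
    have h1 := hasFDerivAt_bergmanKernel_right hD.isOpen hD.zero_mem hz
    have h2 := HasDerivAt.comp_hasFDerivAt (f := fun w => bergmanKernel D w w)
      (0 : Fin n → ℂ) (hasDerivAt_inv hne)
      hD.hasFDerivAt_bergmanKernel_diag
    have h3 := (h1.mul h2).congr_fderiv (g' := (bergmanKernel D 0 0)⁻¹ •
      conjForm (fderiv ℂ (fun w => bergmanKernel D w z) 0))
      (ContinuousLinearMap.ext fun v => by simp)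
    have hq : bergmanKernel D z 0 * ((fun x => x⁻¹) ∘ fun w => bergmanKernel D w w) 0 = 1 := by
      simp [hD.bergmanKernel_zero_right hz, hne]
    have h4 := HasDerivAt.comp_hasFDerivAt (f := (fun w => bergmanKernel D z w) *
      (fun x => x⁻¹) ∘ fun w => bergmanKernel D w w) (0 : Fin n → ℂ)
      (Complex.hasDerivAt_log (by rw [Pi.mul_apply, hq]; exact Complex.one_mem_slitPlane)) h3
    refine h4.congr_fderiv ?_
    rw [Pi.mul_apply, hq, inv_one, one_smul]
  rw [bergmanCoord, hD.bergmanTensor_eq, kernelCoord]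
  simp only [hgrad]
  have h1 : ((bergmanKernel D 0 0)⁻¹ • kernelHess D)⁻¹ =
      bergmanKernel D 0 0 • (kernelHess D)⁻¹ := by
    refine Matrix.inv_eq_left_inv ?_
    rw [Matrix.smul_mul, Matrix.mul_smul, smul_smul, mul_inv_cancel₀ hne, one_smul,
      Matrix.nonsing_inv_mul _ (isUnit_det_kernelHess hD.isOpen hD.isBounded hD.zero_mem)]
  have h2 : (fun i => (bergmanKernel D 0 0)⁻¹ * kernelGrad D i z) =
      (bergmanKernel D 0 0)⁻¹ • fun i => kernelGrad D i z := rfl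
  rw [h1, h2, Matrix.mulVec_smul, Matrix.smul_mulVec, smul_smul, inv_mul_cancel₀ hne, one_smul]

theorem IsQuasiReinhardt.kernelCoord_zero (hD : IsQuasiReinhardt m D) : kernelCoord D 0 = 0 := by
  have h : ∀ i, kernelGrad D i 0 = 0 := by
    intro i
    have h1 : HasFDerivAt (fun w => bergmanKernel D w 0) (0 : (Fin n → ℂ) →L[ℂ] ℂ) 0 := by
      refine (hasFDerivAt_const (bergmanKernel D 0 0) _).congr_of_eventuallyEq ?_
      filter_upwards [hD.isOpen.mem_nhds hD.zero_mem] with w hw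
      exact hD.bergmanKernel_zero_right hw
    rw [kernelGrad, h1.fderiv]
    simp
  rw [kernelCoord]
  simp only [h]
  exact Matrix.mulVec_zero _

/-- In representative coordinates a biholomorphism of quasi-Reinhardt domains fixing the origin is
linear. -/
theorem IsQuasiReinhardt.fderiv_kernelCoord {r' : ℕ} {m' : Fin n → Fin r' → ℤ}
    {D' : Set (Fin n → ℂ)} (hD : IsQuasiReinhardt m D) (hD' : IsQuasiReinhardt m' D')
    {f : (Fin n → ℂ) → (Fin n → ℂ)} (hf : IsBiholomorphism f D D') (hf0 : f 0 = 0)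
    {z : Fin n → ℂ} (hz : z ∈ D) :
    fderiv ℂ f 0 (kernelCoord D z) = kernelCoord D' (f z) := by
  obtain ⟨s, hs⟩ := hD.exists_bergmanKernel_eq hD' hf hf0
  set F : Matrix (Fin n) (Fin n) ℂ := Matrix.of fun l i => fderiv ℂ f 0 (Pi.single i 1) l with hF
  have hFv : ∀ v, F.mulVec v = fderiv ℂ f 0 v := by
    intro v
    ext l
    have h := clm_apply_eq_sum ((ContinuousLinearMap.proj l).comp (fderiv ℂ f 0)) v
    simp only [ContinuousLinearMap.comp_apply, ContinuousLinearMap.proj_apply] at h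
    rw [h]
    simp only [Matrix.mulVec, dotProduct, hF, Matrix.of_apply, mul_comm]
  have hfd : HasFDerivAt f (fderiv ℂ f 0) 0 :=
    (hf.1.differentiableAt (hD.isOpen.mem_nhds hD.zero_mem)).hasFDerivAt
  have hcomp : ∀ g : (Fin n → ℂ) → ℂ, DifferentiableOn ℂ g D' → ∀ v,
      fderiv ℂ (fun w => g (f w)) 0 v = fderiv ℂ g 0 (fderiv ℂ f 0 v) := by
    intro g hg v
    have h1 : HasFDerivAt g (fderiv ℂ g 0) (f 0) := by
      rw [hf0]
      exact (hg.differentiableAt (hD'.isOpen.mem_nhds hD'.zero_mem)).hasFDerivAt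
    have h2 : HasFDerivAt (fun w => g (f w)) ((fderiv ℂ g 0).comp (fderiv ℂ f 0)) 0 :=
      h1.comp 0 hfd
    rw [h2.fderiv]
    rfl
  have hdc : ∀ g : (Fin n → ℂ) → ℂ, DifferentiableOn ℂ g D' →
      DifferentiableAt ℂ (fun w => g (f w)) 0 := fun g hg =>
    (hg.comp hf.1 hf.2.1).differentiableAt (hD.isOpen.mem_nhds hD.zero_mem)
  have hgrad : ∀ z ∈ D, ∀ i, kernelGrad D i z =
      s * ∑ l, conj (F l i) * kernelGrad D' l (f z) := by
    intro z hz i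
    have hd := ((isBergmanKernel hD'.isOpen).mem (f z) (hf.2.1 hz)).1
    have h1 : (fun w => bergmanKernel D w z) =ᶠ[𝓝 0]
        fun w => (s : ℂ) * bergmanKernel D' (f w) (f z) := by
      filter_upwards [hD.isOpen.mem_nhds hD.zero_mem] with w hw
      exact hs w hw z hz
    rw [kernelGrad, h1.fderiv_eq, fderiv_const_mul (hdc _ hd), smul_apply,
      hcomp _ hd, clm_apply_eq_sum]
    simp only [smul_eq_mul, map_mul, map_sum, Complex.conj_ofReal]
    rfl
  -- Differentiating `hgrad` once more at the origin gives the congruence `A = s F* A' F`.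
  have hhess : kernelHess D = (((s : ℂ) • F.conjTranspose) * kernelHess D') * F := by
    ext i k
    have hd := fun l => (kernelGrad_spec hD'.isOpen hD'.zero_mem l).1.1
    have h1 : kernelGrad D i =ᶠ[𝓝 0]
        fun z => (s : ℂ) * ∑ l, conj (F l i) * kernelGrad D' l (f z) := by
      filter_upwards [hD.isOpen.mem_nhds hD.zero_mem] with z hz
      exact hgrad z hz i
    rw [kernelHess, Matrix.of_apply, h1.fderiv_eq,
      fderiv_const_mul (DifferentiableAt.fun_sum fun l _ => (hdc _ (hd l)).const_mul _),
      fderiv_fun_sum fun l _ => (hdc _ (hd l)).const_mul _]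
    simp only [fderiv_const_mul (hdc _ (hd _)), smul_apply,
      sum_apply, hcomp _ (hd _), smul_eq_mul]
    rw [Matrix.mul_assoc, Matrix.smul_mul, Matrix.smul_apply, Matrix.mul_apply, smul_eq_mul]
    congr 1
    refine Finset.sum_congr rfl fun l _ => ?_
    rw [clm_apply_eq_sum, Matrix.mul_apply, Matrix.conjTranspose_apply]
    congr 1
    exact Finset.sum_congr rfl fun p _ => mul_comm _ _
  -- Both sides of the goal agree after multiplication by `s F* A'`, which is invertible because it
  -- is a factor of the invertible matrix `A`.
  have hunit := isUnit_det_kernelHess hD.isOpen hD.isBounded hD.zero_mem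
  rw [hhess, Matrix.det_mul] at hunit
  have hinj := Matrix.mulVec_injective_of_isUnit
    ((Matrix.isUnit_iff_isUnit_det _).2 (isUnit_of_mul_isUnit_left hunit))
  apply hinj
  rw [← hFv, Matrix.mulVec_mulVec, ← hhess,
    kernelHess_mulVec_kernelCoord hD.isOpen hD.isBounded hD.zero_mem, ← Matrix.mulVec_mulVec,
    kernelHess_mulVec_kernelCoord hD'.isOpen hD'.isBounded hD'.zero_mem, Matrix.smul_mulVec]
  ext i
  exact hgrad z hz i

theorem IsQuasiReinhardt.kernelCoord_torusAction (hD : IsQuasiReinhardt m D)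
    (lam : Fin r → Circle) {z : Fin n → ℂ} (hz : z ∈ D) :
    kernelCoord D (torusAction m lam z) = torusAction m lam (kernelCoord D z) := by
  rw [← hD.fderiv_kernelCoord hD (hD.isBiholomorphism_torusAction lam) (torusAction_zero lam) hz,
    fderiv_torusAction, torusCLM_apply]

end RepresentativeCoordinates

/-! ### Equivariant maps -/

section Equivariant

variable {n r : ℕ} {m : Fin n → Fin r → ℤ} {D : Set (Fin n → ℂ)}

theorem contDiff_mvPolynomial_eval (P : MvPolynomial (Fin n) ℂ) :
    ContDiff ℂ 1 fun z : Fin n → ℂ => MvPolynomial.eval z P := by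
  simp only [MvPolynomial.eval_eq']
  fun_prop

/-- An equivariant holomorphic map tangent to the identity at the origin has an equivariant
polynomial left inverse. -/
theorem exists_polynomial_leftInverse (hm : OnlyConstantInvariants m) (hD : IsOpen D)
    (hc : IsPreconnected D) (h0 : 0 ∈ D) {Φ : (Fin n → ℂ) → (Fin n → ℂ)}
    (hΦ : DifferentiableOn ℂ Φ D) (hΦ0 : Φ 0 = 0)
    (hΦ' : HasFDerivAt Φ (ContinuousLinearMap.id ℂ (Fin n → ℂ)) 0)
    (hρ : ∀ lam, ∀ z ∈ D, Φ (torusAction m lam z) = torusAction m lam (Φ z)) :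
    ∃ Q : Fin n → MvPolynomial (Fin n) ℂ, (∀ i, ∀ α ∈ (Q i).support, ⇑α ∈ weightSet m (m i)) ∧
      ∀ z ∈ D, ∀ i, MvPolynomial.eval (Φ z) (Q i) = z i := by
  -- Equivariance already makes `Φ` polynomial, which supplies the smoothness for the inverse
  -- function theorem.
  have hcd : ContDiffAt ℂ 1 Φ 0 := by
    rw [contDiffAt_pi]
    intro i
    obtain ⟨P, -, hP⟩ := IsSemiInvariantOn.exists_polynomial (M := m i) (g := fun z => Φ z i) hm hD
      hc h0 (differentiableOn_pi.1 hΦ i) fun lam z hz => congrFun (hρ lam z hz) i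
    refine (contDiff_mvPolynomial_eval P).contDiffAt.congr_of_eventuallyEq ?_
    filter_upwards [hD.mem_nhds h0] with z hz
    exact hP z hz
  have hΦ'' : HasFDerivAt Φ ((ContinuousLinearEquiv.refl ℂ (Fin n → ℂ) :
    (Fin n → ℂ) ≃L[ℂ] (Fin n → ℂ)) : (Fin n → ℂ) →L[ℂ] (Fin n → ℂ)) 0 := hΦ'
  have hst := hcd.hasStrictFDerivAt' hΦ'' one_ne_zero
  have hinv := hcd.to_localInverse hΦ'' one_ne_zero
  set g := hcd.localInverse hΦ'' one_ne_zero with hg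
  have hg0 : g 0 = 0 := by
    have := hst.localInverse_apply_image
    rwa [hΦ0] at this
  have hleft : ∀ᶠ x in 𝓝 0, g (Φ x) = x := hst.eventually_left_inverse
  have hright : ∀ᶠ y in 𝓝 0, Φ (g y) = y := by
    have := hst.eventually_right_inverse
    rwa [hΦ0] at this
  rw [hΦ0] at hinv
  obtain ⟨ε₁, hε₁, hball₁⟩ := Metric.mem_nhds_iff.1 (hleft.and (hD.mem_nhds h0))
  have hgc : Tendsto g (𝓝 0) (𝓝 0) := by
    have := hinv.continuousAt.tendsto
    rwa [hg0] at this
  obtain ⟨ε, hε, hball⟩ := Metric.mem_nhds_iff.1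
    ((hright.and (hgc (ball_mem_nhds 0 hε₁))).and (hinv.eventually (by simp)))
  have hpoly : ∀ i, ∃ Q : MvPolynomial (Fin n) ℂ, (∀ α ∈ Q.support, ⇑α ∈ weightSet m (m i)) ∧
      ∀ y ∈ ball (0 : Fin n → ℂ) ε, g y i = MvPolynomial.eval y Q := by
    intro i
    refine IsSemiInvariantOn.exists_polynomial_ball hm hε (g := fun y => g y i) ?_ ?_
    · intro y hy
      have := (hball hy).2.differentiableAt one_ne_zero
      exact (differentiableAt_pi.1 this i).differentiableWithinAt
    -- The local inverse inherits equivariance: the action keeps `g y` in the ball where `g ∘ Φ` is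
    -- the identity, and `Φ` sends the moved point to the moved `y`.
    · intro lam y hy
      have h1 : g y ∈ ball (0 : Fin n → ℂ) ε₁ := (hball hy).1.2
      have h2 := (hball₁ (torusAction_mem_ball (m := m) (lam := lam) h1)).1
      rw [hρ lam _ (hball₁ h1).2, (hball hy).1.1] at h2
      exact congrFun h2 i
  choose Q hQ hQe using hpoly
  refine ⟨Q, hQ, fun z hz i => sub_eq_zero.1 ?_⟩
  -- Unlike the local inverse, its polynomial `Q` can be composed with `Φ` on all of `D`.
  refine eqOn_zero_of_eventuallyEq_zero (g := fun z => MvPolynomial.eval (Φ z) (Q i) - z i) hD hc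
    ?_ h0 ?_ z hz
  · exact ((differentiable_mvPolynomial_eval (Q i)).comp_differentiableOn hΦ).sub
      (differentiable_apply i).differentiableOn
  · have hΦc : Tendsto Φ (𝓝 0) (𝓝 0) := by
      have := hcd.continuousAt.tendsto
      rwa [hΦ0] at this
    filter_upwards [hleft, hΦc (ball_mem_nhds 0 hε)] with x hx hx'
    simp [← hQe i _ hx', hx]

end Equivariant

/-! ### Injectivity, polynomiality and degree bounds. -/

section Main

variable {n r : ℕ} {m : Fin n → Fin r → ℤ} {D : Set (Fin n → ℂ)}

/-- The representative coordinates and their inverse are polynomial maps. -/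
theorem IsQuasiReinhardt.bergmanCoord_polynomial (hD : IsQuasiReinhardt m D) :
    InjOn (bergmanCoord D 0) D ∧
      IsPolynomialMapOn (bergmanCoord D 0) D (resonanceOrder m) ∧
      IsPolynomialMapOn (Function.invFunOn (bergmanCoord D 0) D) (bergmanCoord D 0 '' D)
        (resonanceOrder m) := by
  have hm := hD.onlyConstantInvariants
  have hdiff := differentiableOn_kernelCoord hD.isOpen hD.zero_mem
  obtain ⟨Q, hQ, hQe⟩ := exists_polynomial_leftInverse hm hD.isOpen hD.isConnected.isPreconnected
    hD.zero_mem hdiff hD.kernelCoord_zero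
    (hasFDerivAt_kernelCoord hD.isOpen hD.isBounded hD.zero_mem)
    fun lam z hz => hD.kernelCoord_torusAction lam hz
  have hinj : InjOn (bergmanCoord D 0) D := by
    intro z hz w hw hzw
    rw [hD.bergmanCoord_eq hz, hD.bergmanCoord_eq hw] at hzw
    ext i
    rw [← hQe z hz i, ← hQe w hw i, hzw]
  refine ⟨hinj, ?_, Q, fun i => totalDegree_le_resonanceOrder hm (hQ i), ?_⟩
  · choose P hP hPe using fun i => IsSemiInvariantOn.exists_polynomial (M := m i)
      (g := fun z => kernelCoord D z i) hm hD.isOpen hD.isConnected.isPreconnected hD.zero_mem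
      (differentiableOn_pi.1 hdiff i)
      fun lam z hz => congrFun (hD.kernelCoord_torusAction lam hz) i
    refine ⟨P, fun i => totalDegree_le_resonanceOrder hm (hP i), fun z hz i => ?_⟩
    rw [hD.bergmanCoord_eq hz]
    exact hPe i z hz
  · rintro _ ⟨z, hz, rfl⟩ i
    rw [hinj.leftInvOn_invFunOn hz, hD.bergmanCoord_eq hz, hQe z hz i]

end Main

end QuasiReinhardt

end

theorem theorem1p1 {n r₁ r₂ : ℕ} (m₁ : Fin n → Fin r₁ → ℤ) (m₂ : Fin n → Fin r₂ → ℤ)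
    (D₁ D₂ : Set (Fin n → ℂ))
    (hD₁ : QuasiReinhardt.IsQuasiReinhardt m₁ D₁) (hD₂ : QuasiReinhardt.IsQuasiReinhardt m₂ D₂)
    (f : (Fin n → ℂ) → (Fin n → ℂ)) (hf : QuasiReinhardt.IsBiholomorphism f D₁ D₂)
    (hf0 : f 0 = 0) :
    -- both representative coordinate maps are injective, so that their inverses are defined
    (Set.InjOn (QuasiReinhardt.bergmanCoord D₁ 0) D₁ ∧
      Set.InjOn (QuasiReinhardt.bergmanCoord D₂ 0) D₂) ∧
    -- the description of f
    (Set.MapsTo (fderiv ℂ f 0) (QuasiReinhardt.bergmanCoord D₁ 0 '' D₁)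
        (QuasiReinhardt.bergmanCoord D₂ 0 '' D₂) ∧
      ∀ z ∈ D₁, f z = Function.invFunOn (QuasiReinhardt.bergmanCoord D₂ 0) D₂
        (fderiv ℂ f 0 (QuasiReinhardt.bergmanCoord D₁ 0 z))) ∧
    -- the degree bounds
    (QuasiReinhardt.IsPolynomialMapOn (QuasiReinhardt.bergmanCoord D₁ 0) D₁
        (QuasiReinhardt.resonanceOrder m₁) ∧
      QuasiReinhardt.IsPolynomialMapOn
        (Function.invFunOn (QuasiReinhardt.bergmanCoord D₁ 0) D₁)
        (QuasiReinhardt.bergmanCoord D₁ 0 '' D₁) (QuasiReinhardt.resonanceOrder m₁) ∧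
      QuasiReinhardt.IsPolynomialMapOn (QuasiReinhardt.bergmanCoord D₂ 0) D₂
        (QuasiReinhardt.resonanceOrder m₂) ∧
      QuasiReinhardt.IsPolynomialMapOn
        (Function.invFunOn (QuasiReinhardt.bergmanCoord D₂ 0) D₂)
        (QuasiReinhardt.bergmanCoord D₂ 0 '' D₂) (QuasiReinhardt.resonanceOrder m₂)) := by
  obtain ⟨hinj₁, hP₁, hQ₁⟩ := hD₁.bergmanCoord_polynomial
  obtain ⟨hinj₂, hP₂, hQ₂⟩ := hD₂.bergmanCoord_polynomial
  have key : ∀ z ∈ D₁, fderiv ℂ f 0 (QuasiReinhardt.bergmanCoord D₁ 0 z) =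
      QuasiReinhardt.bergmanCoord D₂ 0 (f z) := fun z hz => by
    rw [hD₁.bergmanCoord_eq hz, hD₂.bergmanCoord_eq (hf.2.1 hz)]
    exact hD₁.fderiv_kernelCoord hD₂ hf hf0 hz
  refine ⟨⟨hinj₁, hinj₂⟩, ⟨?_, fun z hz => ?_⟩, hP₁, hQ₁, hP₂, hQ₂⟩
  · rintro _ ⟨z, hz, rfl⟩
    exact ⟨f z, hf.2.1 hz, (key z hz).symm⟩
  · rw [key z hz, hinj₂.leftInvOn_invFunOn (hf.2.1 hz)]
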